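/- **Model.** There are $n\ge 2$ items with scores $\theta_1\ge\theta_2\ge\dots\ge\theta_n>0$, where $\theta_i=e^{\mu_i}$, and $1\le k<n$ with $\theta_k>\theta_{k+1}$. The items carry the labels $1,\dots,n$ in a uniformly random order, and the algorithm only sees labels. A comparison of two labels reports one of them; items $i,j$ are compared with result $i$ with probability $\theta_i/(\theta_i+\theta_j)$, independently of all other comparisons. **Algorithm** $\textsf{AlgPairwise}(\Omega,k)$, with integer parameters $\kappa,q_0\ge 1$, where $|\Omega|=m$. If $m\le 1$, return $\Omega$ if $k\geq 1$ and $\emptyset$ if $k=0$, without comparisons. Otherwise draw $s=m\kappa$ two-element subsets $S_1,\dots,S_s$ of $\Omega$ independently and uniformly; they are the edges of a (multi)graph on $\Omega$. Start with $\Omega_g=\Omega_b=\emptyset$. In round $q=1,2,\dots$ compare each pair $S_u$ once. For $S_u=\{i,j\}$ let $\rho\in[0,\infty]$ be the number of times $i$ was reported for $S_u$ so far divided by the number of times $j$ was, and let $x=\sqrt{\kappa/q}$. Seen from $i$, the edge $S_u$ is labelled $>$ if $\rho\ge 1+32\kappa x$; $\ge$ if $1+4x<\rho<1+32\kappa x$;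 $\approx$ if $\frac1{1+4x}\le\rho\le 1+4x$; $\le$ if $\frac1{1+32\kappa x}<\rho<\frac1{1+4x}$; $<$ if $\rho\le\frac1{1+32\kappa x}$. Write $i\gg j$ if there is a path from $i$ to $j$ with at most $\kappa$ edges, each labelled $\approx$, $\ge$ or $>$ in the direction of the path and at least one labelled $>$. In every round $q\ge q_0$: add to $\Omega_b$ every $i\in\Omega$ for which at least $k$ labels $j\in\Omega$ satisfy $j\gg i$; add to $\Omega_g$ every $i\in\Omega$ for which at least $m-k$ labels $j\in\Omega$ satisfy $i\gg j$; stop the rounds if $|\Omega_g\cup\Omega_b|\ge m/4$. Then return $\Omega_g\cup\textsf{AlgPairwise}(\Omega\setminus(\Omega_g\cup\Omega_b),\,k-|\Omega_g|)$, where the recursive call uses the same $\kappa$ and $q_0$ and fresh randomness. **Theorem.** There is a constant $A_0$ such that for every integer $A\ge A_0$ there is a constant $K$ such that for every $c>0$ there is a constant $C$ with the following property. For all $n,k,\theta_1,\dots,\theta_n$ as above and every integer $$\kappa\;\ge\; C\left(\log^2 n+\log\Bigl(1+\log\frac{\theta_k}{\theta_k-\theta_{k+1}}\Bigr)\right),$$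 $\textsf{AlgPairwise}(\{1,\dots,n\},k)$ with parameters $\kappa$ and $q_0=A\kappa^3$ halts, returns exactly the set of labels of the top $k$ items $1,\dots,k$, and uses at most $$K\,\kappa^7\left(k+\sum_{i=k+1}^n\frac{\theta_k^2}{(\theta_k-\theta_i)^2}+\sum_{i=1}^k\frac{\theta_{k+1}^2}{(\theta_{k+1}-\theta_i)^2}\right)$$ pairwise comparisons, with probability at least $1-n^{-c}$. (In particular one can take $\kappa=\Theta(\log^2 n)$ whenever $\theta_k/(\theta_k-\theta_{k+1})\le e^{e^{\log^2 n}}$.) -/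

import Mathlib

open MeasureTheory ProbabilityTheory

namespace TopK

noncomputable section

/-! ### The comparison model -/

/-- The multinomial logit (Bradley-Terry) law of the reported item when the pair `p` of labels is
compared: the item with utility `v a` is reported with probability proportional to `exp (v a)`. -/
def compareLaw {n : ℕ} (v : Fin n → ℝ) (p : Fin n × Fin n) : Measure (Fin n) :=
  ENNReal.ofReal (Real.exp (v p.1) / (Real.exp (v p.1) + Real.exp (v p.2))) • Measure.dirac p.1 +
  ENNReal.ofReal (Real.exp (v p.2) / (Real.exp (v p.1) + Real.exp (v p.2))) • Measure.dirac p.2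

instance {n : ℕ} (v : Fin n → ℝ) (p : Fin n × Fin n) : IsProbabilityMeasure (compareLaw v p) := by
  constructor
  have h1 := Real.exp_pos (v p.1)
  have h2 := Real.exp_pos (v p.2)
  simp only [compareLaw, Measure.coe_add, Measure.coe_smul, Pi.add_apply, Pi.smul_apply,
    measure_univ, smul_eq_mul, mul_one]
  rw [← ENNReal.ofReal_add (by positivity) (by positivity), ← add_div, div_self (by positivity),
    ENNReal.ofReal_one]

/-! ### Edge labels and strictly label monotone paths

In one call of the algorithm, `E u` is the `u`-th sampled pair and `R (p, u)` is the item reported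
by the comparison of that pair in round `p` (rounds are numbered from `0`). -/

/-- The five labels `≈`, `≥`, `>`, `≤`, `<` of an edge seen from its first endpoint. -/
inductive EdgeLabel
  | approx | ge | gt | le | lt

open Classical in
/-- The label of an edge `(i, j)` after `q` rounds in which `i` was reported `a` times and `j` was
reported `b` times. The cases are those of the ratio `a / b`, where `a / 0` counts as `∞` (so it
gives the label `>`):
`>` on `[1 + 32κ√(κ/q), ∞]`, `≥` on `(1 + 4√(κ/q), 1 + 32κ√(κ/q))`,
`≈` on `[1 / (1 + 4√(κ/q)), 1 + 4√(κ/q)]`, `≤` on `(1 / (1 + 32κ√(κ/q)), 1 / (1 + 4√(κ/q)))`,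
`<` on `[0, 1 / (1 + 32κ√(κ/q))]`. -/
def edgeLabel (κ q a b : ℕ) : EdgeLabel :=
  let x : ℝ := Real.sqrt ((κ : ℝ) / q)
  if (1 + 32 * κ * x) * b ≤ (a : ℝ) then .gt
  else if (1 + 4 * x) * b < (a : ℝ) then .ge
  else if (b : ℝ) ≤ (1 + 4 * x) * a then .approx
  else if (b : ℝ) < (1 + 32 * κ * x) * a then .le
  else .lt

/-- How often item `i` was reported for the pair `u` in the first `q` rounds. -/
def wins {n s : ℕ} (R : ℕ × Fin s → Fin n) (q : ℕ) (u : Fin s) (i : Fin n) : ℕ :=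
  ((Finset.range q).filter fun p => R (p, u) = i).card

/-- After `q` rounds, the sampled pair `u` is an edge between `i` and `j`, and its label seen
from `i` is `l`. -/
def HasLabel {n s : ℕ} (κ : ℕ) (E : Fin s → Fin n × Fin n) (R : ℕ × Fin s → Fin n) (q : ℕ)
    (u : Fin s) (i j : Fin n) (l : EdgeLabel) : Prop :=
  (E u = (i, j) ∨ E u = (j, i)) ∧ edgeLabel κ q (wins R q u i) (wins R q u j) = l

/-- `i >> j` after `q` rounds: there is a strictly label monotone path `x 0 → x 1 → ⋯ → x d` of
length `d ≤ κ` from `i` to `j`, along the edges `e 0, …, e (d - 1)`. -/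
def StrictlyAbove {n s : ℕ} (κ : ℕ) (E : Fin s → Fin n × Fin n) (R : ℕ × Fin s → Fin n) (q : ℕ)
    (i j : Fin n) : Prop :=
  ∃ (d : ℕ) (x : ℕ → Fin n) (e : ℕ → Fin s), d ≤ κ ∧ x 0 = i ∧ x d = j ∧
    (∀ r < d, HasLabel κ E R q (e r) (x r) (x (r + 1)) .approx ∨
      HasLabel κ E R q (e r) (x r) (x (r + 1)) .ge ∨
      HasLabel κ E R q (e r) (x r) (x (r + 1)) .gt) ∧
    ∃ r < d, HasLabel κ E R q (e r) (x r) (x (r + 1)) .gt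

/-! ### One call of the algorithm on a set `W` of labels -/

open Classical in
/-- `Ω_b` after round `q`: the items of `W` that, in some round from `q₀` up to `q`, had at least
`k` items of `W` strictly above them. -/
def rejected {n s : ℕ} (κ q₀ : ℕ) (W : Finset (Fin n)) (k : ℕ) (E : Fin s → Fin n × Fin n)
    (R : ℕ × Fin s → Fin n) (q : ℕ) : Finset (Fin n) :=
  W.filter fun i => ∃ p, q₀ ≤ p ∧ p ≤ q ∧ k ≤ (W.filter fun j => StrictlyAbove κ E R p j i).card

open Classical in
/-- `Ω_g` after round `q`: the items of `W` that, in some round from `q₀` up to `q`, were strictly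
above at least `|W| - k` items of `W`. -/
def accepted {n s : ℕ} (κ q₀ : ℕ) (W : Finset (Fin n)) (k : ℕ) (E : Fin s → Fin n × Fin n)
    (R : ℕ × Fin s → Fin n) (q : ℕ) : Finset (Fin n) :=
  W.filter fun i => ∃ p, q₀ ≤ p ∧ p ≤ q ∧
    W.card - k ≤ (W.filter fun j => StrictlyAbove κ E R p i j).card

/-- The condition `|Ω_g ∪ Ω_b| ≥ |W| / 4` for leaving the loop, tested from round `q₀` on. -/
def Breaks {n s : ℕ} (κ q₀ : ℕ) (W : Finset (Fin n)) (k : ℕ) (E : Fin s → Fin n × Fin n)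
    (R : ℕ × Fin s → Fin n) (q : ℕ) : Prop :=
  q₀ ≤ q ∧ W.card ≤ 4 * (accepted κ q₀ W k E R q ∪ rejected κ q₀ W k E R q).card

open Classical in
/-- The result `(Ω_g, Ω_b, q)` of the loop, where `q` is the first round in which it is left;
`none` if it is never left. -/
def loopResult {n s : ℕ} (κ q₀ : ℕ) (W : Finset (Fin n)) (k : ℕ) (E : Fin s → Fin n × Fin n)
    (R : ℕ × Fin s → Fin n) : Option (Finset (Fin n) × Finset (Fin n) × ℕ) :=
  if h : ∃ q, Breaks κ q₀ W k E R q then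
    some (accepted κ q₀ W k E R (Nat.find h), rejected κ q₀ W k E R (Nat.find h), Nat.find h)
  else none

/-- How a run ends: it halts with the output `S` after `t` comparisons, or it never halts. -/
inductive Outcome (n : ℕ)
  | halted (S : Finset (Fin n)) (t : ℕ)
  | diverged

instance (n : ℕ) : MeasurableSpace (Outcome n) := ⊤

/-- Add the accepted items `G` and `t` comparisons to the outcome of the recursive call. -/
def Outcome.extend {n : ℕ} (G : Finset (Fin n)) (t : ℕ) : Outcome n → Outcome n
  | .halted S t' => .halted (G ∪ S) (t + t')
  | .diverged => .diverged

/-- The law of the outcome of `AlgPairwise (W, k)` with parameter `κ`, when the item labelled `a`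
has utility `v a`; the labels of the edges are evaluated from round `q₀` on.

A set of at most one label needs no comparison. Otherwise `s = |W| κ` pairs `E u` are drawn
independently and uniformly from the pairs of distinct elements of `W`, and each pair is compared
once per round, all answers `R (p, u)` being independent. If the loop is left in round `q`, it has
used `s * q` comparisons, and the algorithm is called on `W \ Ω_g \ Ω_b` with `k - |Ω_g|` and
fresh randomness. -/
def algPairwise {n : ℕ} (κ q₀ : ℕ) (v : Fin n → ℝ) (W : Finset (Fin n)) (k : ℕ) :
    Measure (Outcome n) :=
  if W.card ≤ 1 then Measure.dirac (.halted (if k = 0 then ∅ else W) 0)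
  else
    (Measure.pi fun _ : Fin (W.card * κ) =>
      uniformOn (W.offDiag : Set (Fin n × Fin n))).bind fun E =>
    (Measure.infinitePi fun i : ℕ × Fin (W.card * κ) => compareLaw v (E i.2)).bind fun R =>
      match loopResult κ q₀ W k E R with
      | none => Measure.dirac .diverged
      | some (G, B, q) =>
        -- the test always succeeds (it is only there for the recursion to be well-founded)
        if ((W \ G) \ B).card < W.card then
          (algPairwise κ q₀ v ((W \ G) \ B) (k - G.card)).map
            (Outcome.extend G (W.card * κ * q))
        else Measure.dirac .diverged
termination_by W.card

/-! ### Random labels, success, and the instance complexity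

Items are numbered `1, …, n` by rank, labels are the elements of `Fin n`, and under the
permutation `π` the item `i` carries the label `π (i - 1)`. -/

/-- The rank (from `1` to `n`) of the item that carries the label `a`. -/
def rankOf {n : ℕ} (π : Equiv.Perm (Fin n)) (a : Fin n) : ℕ := (π.symm a : ℕ) + 1

/-- The labels of the items `1, …, k`. -/
def topLabels {n : ℕ} (π : Equiv.Perm (Fin n)) (k : ℕ) : Finset (Fin n) :=
  Finset.univ.filter fun a => rankOf π a ≤ k

/-- The probability that the algorithm, run on a uniformly random labelling of `n` items with
utilities `v 1, …, v n`, halts after at most `T` comparisons and returns exactly the labels of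
the top `k` items. -/
def successProb (κ q₀ n k : ℕ) (v : ℕ → ℝ) (T : ℝ) : ENNReal :=
  (∑ π : Equiv.Perm (Fin n), algPairwise κ q₀ (fun a => v (rankOf π a)) Finset.univ k
    {o | ∃ t : ℕ, o = .halted (topLabels π k) t ∧ (t : ℝ) ≤ T}) / (n.factorial : ENNReal)

/-- `k + ∑_{i > k} θ_k² / (θ_k - θ_i)² + ∑_{i ≤ k} θ_{k+1}² / (θ_{k+1} - θ_i)²`. -/
def complexity (n k : ℕ) (θ : ℕ → ℝ) : ℝ :=
  k + ∑ i ∈ Finset.Icc (k + 1) n, θ k ^ 2 / (θ k - θ i) ^ 2 +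
    ∑ i ∈ Finset.Icc 1 k, θ (k + 1) ^ 2 / (θ (k + 1) - θ i) ^ 2

end

end TopK

/-! Consider one call on a set `W` of `m` labels listed by decreasing utility, with `T` the top
labels, and put x = √(κ/q). Two events make the call behave.

Concentration: in every round q < 2^l all win counts deviate from their means by at most √(κq)/2.
Doob's maximal inequality handles a dyadic block of rounds at once, so only l blocks enter the union
bound (`answerLaw_not_concentrated`). Since l is of order log(κρ) for ρ = θ_k/(θ_k - θ_{k+1}), this
is the source of the term log(1 + log ρ). Expansion: sets of positions have many neighbours in every
disjoint window of length about m/(16 log n) (`pairLaw_not_expanding`). Growing a neighbourhood by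
factors of three through consecutive windows joins any two positions more than m/8 apart by a path
of logarithmic length along decreasing utility (`Expanding.short_path`). Windows this short are the
reason for log² n.

Under concentration an upward label can hide a rise of at most 1 + 10x, whereas a label > certifies
a drop by 1 + 20κx. Over at most κ edges the drop wins, so ≫ never errs (`StrictlyAbove.lt`).
Conversely, if the endpoints of a path along decreasing utility have relative gap at least 80κ²x,
some edge of the path must be labelled > (`IncPath.strictlyAbove`).

If at most half of `W` lies in `T`, the worst quarter is far in position from all of `W ∩ T`. It is
rejected once q is about κ⁵ times the weight w of its best member, and the at least m/4 items
between the boundary and that member weigh at least w each, so m·w is at most four times the total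
weight. The other case is symmetric (`Separates.exists_breaks`). Hence a call costs O(κ⁶) times the
complexity: κ⁵ from the rounds, κ from the number of pairs per label. Each call removes a quarter of
the labels, so there are O(log n) ≤ κ levels (`Separates.algPairwise_fail_le`), which gives κ⁷.
Everything holds for each fixed labelling. -/

namespace TopK

/-! ### Maximal inequalities for bounded independent sums -/

section Concentration

variable {Ω : Type*} [MeasurableSpace Ω] {μ : Measure Ω} [IsProbabilityMeasure μ]

/-- By independence, the conditional expectation of the new factor is its mean, which is at least 1
because e^y ≥ 1 + y and the increments are centred. -/
theorem submartingale_exp_sum {Y : ℕ → Ω → ℝ} {c : NNReal} (hm : ∀ i, StronglyMeasurable (Y i))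
    (hi : iIndepFun Y μ) (hs : ∀ i, HasSubgaussianMGF (Y i) c μ) (h0 : ∀ i, μ[Y i] = 0) (l : ℝ) :
    Submartingale (fun j ω => Real.exp (l * ∑ i ∈ Finset.range (j + 1), Y i ω))
      (Filtration.natural Y hm) μ := by
  have hsum : ∀ j, HasSubgaussianMGF (fun ω => ∑ i ∈ Finset.range j, Y i ω)
      (∑ i ∈ Finset.range j, c) μ := fun j =>
    HasSubgaussianMGF.sum_of_iIndepFun hi (fun i _ => hs i)
  have hYm : ∀ i j, i ≤ j → Measurable[Filtration.natural Y hm j] (Y i) := fun i j hij =>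
    ((Filtration.stronglyAdapted_natural hm i).mono
      ((Filtration.natural Y hm).mono hij)).measurable
  have hadp : ∀ j, StronglyMeasurable[Filtration.natural Y hm j]
      (fun ω => Real.exp (l * ∑ i ∈ Finset.range (j + 1), Y i ω)) := by
    intro j
    apply Measurable.stronglyMeasurable
    apply Real.measurable_exp.comp
    apply Measurable.const_mul
    exact Finset.measurable_fun_sum _ fun i hi =>
      hYm i j (Nat.lt_succ_iff.1 (Finset.mem_range.1 hi))
  refine submartingale_nat hadp (fun j => (hsum (j + 1)).integrable_exp_mul l) fun j => ?_
  have hsplit : (fun ω => Real.exp (l * ∑ i ∈ Finset.range (j + 1 + 1), Y i ω)) =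
      (fun ω => Real.exp (l * ∑ i ∈ Finset.range (j + 1), Y i ω)) *
        fun ω => Real.exp (l * Y (j + 1) ω) := by
    ext ω
    rw [Pi.mul_apply, ← Real.exp_add, Finset.sum_range_succ, mul_add]
  have h1 := condExp_mul_of_stronglyMeasurable_left (μ := μ) (hadp j)
    (hsplit ▸ (hsum (j + 1 + 1)).integrable_exp_mul l) ((hs (j + 1)).integrable_exp_mul l)
  have h2 : μ[fun ω => Real.exp (l * Y (j + 1) ω) | Filtration.natural Y hm j] =ᵐ[μ]
      fun _ => μ[fun ω => Real.exp (l * Y (j + 1) ω)] := by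
    refine condExp_indep_eq (hm (j + 1)).measurable.comap_le (Filtration.le _ _) ?_
      (hi.indep_comap_natural_of_lt hm (Nat.lt_succ_self j))
    exact (Real.measurable_exp.comp
      ((comap_measurable (Y (j + 1))).const_mul l)).stronglyMeasurable
  have h3 : 1 ≤ μ[fun ω => Real.exp (l * Y (j + 1) ω)] := by
    have h4 : μ[fun ω => l * Y (j + 1) ω + 1] = 1 := by
      rw [integral_add ((hs (j + 1)).integrable.const_mul l) (integrable_const _),
        integral_const_mul, h0]
      simp
    rw [← h4]
    exact integral_mono (((hs (j + 1)).integrable.const_mul l).add (integrable_const _))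
      ((hs (j + 1)).integrable_exp_mul l) fun ω => Real.add_one_le_exp _
  rw [hsplit]
  filter_upwards [h1, h2] with ω h1 h2
  rw [h1, Pi.mul_apply, h2]
  exact le_mul_of_one_le_right (Real.exp_pos _).le h3

/-- Doob's inequality for the exponential submartingale controls all partial sums up to `N` by the
moment at time `N` alone; the Chernoff exponent is then optimised at l = t/(Nc). -/
theorem maximal_subgaussian {Y : ℕ → Ω → ℝ} {c : NNReal} (hm : ∀ i, StronglyMeasurable (Y i))
    (hi : iIndepFun Y μ) (hs : ∀ i, HasSubgaussianMGF (Y i) c μ) (h0 : ∀ i, μ[Y i] = 0)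
    (N : ℕ) (hN : 0 < N) (hc : 0 < c) {t : ℝ} (ht : 0 < t) :
    μ {ω | ∃ q ≤ N, t ≤ ∑ i ∈ Finset.range q, Y i ω} ≤
      ENNReal.ofReal (Real.exp (-(t ^ 2 / (2 * N * c)))) := by
  have hNc : (0 : ℝ) < N * c := by positivity
  set l : ℝ := t / (N * c) with hl
  have hl0 : 0 < l := by positivity
  have hsub := submartingale_exp_sum hm hi hs h0 l
  set f := fun (j : ℕ) (ω : Ω) => Real.exp (l * ∑ i ∈ Finset.range (j + 1), Y i ω) with hf
  have hpos : 0 ≤ f := fun j ω => (Real.exp_pos _).le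
  set e : NNReal := ⟨Real.exp (l * t), (Real.exp_pos _).le⟩ with he
  have key := maximal_ineq hsub hpos (ε := e) (N - 1)
  set S := {ω | (e : ℝ) ≤ (Finset.range (N - 1 + 1)).sup' Finset.nonempty_range_add_one
    fun k => f k ω} with hS
  have hsubset : {ω | ∃ q ≤ N, t ≤ ∑ i ∈ Finset.range q, Y i ω} ⊆ S := by
    rintro ω ⟨q, hq, htq⟩
    -- The submartingale at index j is built from j + 1 summands, so the empty sum must be excluded
    -- and q corresponds to index q - 1.
    have hq0 : q ≠ 0 := by
      rintro rfl
      simp at htq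
      linarith
    rw [hS, Set.mem_ofPred_eq, Finset.le_sup'_iff]
    refine ⟨q - 1, Finset.mem_range.2 (by omega), ?_⟩
    simp only [hf, he, Nat.sub_add_cancel (Nat.pos_of_ne_zero hq0)]
    exact Real.exp_le_exp.2 (mul_le_mul_of_nonneg_left htq hl0.le)
  have hint : ∫ ω in S, f (N - 1) ω ∂μ ≤ Real.exp (N * c * l ^ 2 / 2) := by
    refine (setIntegral_le_integral (hsub.integrable _) (ae_of_all _ (hpos _))).trans ?_
    have := (HasSubgaussianMGF.sum_of_iIndepFun hi (c := fun _ => c)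
      (s := Finset.range N) (fun i _ => hs i)).mgf_le l
    simp only [Finset.sum_const, Finset.card_range, nsmul_eq_mul, NNReal.coe_mul,
      NNReal.coe_natCast] at this
    simpa [mgf, hf, Nat.sub_add_cancel hN] using this
  have h1 : (e : ENNReal) * μ S ≤ ENNReal.ofReal (Real.exp (N * c * l ^ 2 / 2)) :=
    key.trans (ENNReal.ofReal_le_ofReal hint)
  have he' : (e : ENNReal) = ENNReal.ofReal (Real.exp (l * t)) := by
    rw [ENNReal.ofReal, he]; congr 1; ext; simp only [Real.coe_toNNReal _ (Real.exp_pos _).le]; rfl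
  calc _ ≤ μ S := measure_mono hsubset
    _ = ENNReal.ofReal (Real.exp (-(l * t))) * (e * μ S) := by
        rw [← mul_assoc, he', ← ENNReal.ofReal_mul (Real.exp_pos _).le, ← Real.exp_add]
        simp
    _ ≤ ENNReal.ofReal (Real.exp (-(l * t))) * ENNReal.ofReal (Real.exp (N * c * l ^ 2 / 2)) := by
        gcongr
    _ = _ := by
        rw [← ENNReal.ofReal_mul (Real.exp_pos _).le, ← Real.exp_add]
        congr 2
        rw [hl]
        field_simp
        ring

theorem maximal_abs_of_mem_Icc {X : ℕ → Ω → ℝ} {p : ℝ} (hm : ∀ i, Measurable (X i))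
    (hi : iIndepFun X μ) (hX : ∀ i ω, X i ω ∈ Set.Icc (0 : ℝ) 1) (hp : ∀ i, μ[X i] = p)
    (N : ℕ) (hN : 0 < N) {t : ℝ} (ht : 0 < t) :
    μ {ω | ∃ q ≤ N, t ≤ |∑ i ∈ Finset.range q, X i ω - q * p|} ≤
      2 * ENNReal.ofReal (Real.exp (-(2 * t ^ 2 / N))) := by
  have hs : ∀ i, HasSubgaussianMGF (fun ω => X i ω - p) (1 / 4) μ := by
    intro i
    have := hasSubgaussianMGF_of_mem_Icc (μ := μ) (hm i).aemeasurable (ae_of_all _ (hX i))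
    rw [hp] at this
    convert this using 1
    ext; norm_num
  have h0 : ∀ i, μ[fun ω => X i ω - p] = 0 := by
    intro i
    rw [integral_sub (Integrable.of_mem_Icc 0 1 (hm i).aemeasurable (ae_of_all _ (hX i)))
      (integrable_const _), hp]
    simp
  have hs' : ∀ i, HasSubgaussianMGF (fun ω => -(X i ω - p)) (1 / 4) μ := fun i => (hs i).neg
  have h0' : ∀ i, μ[fun ω => -(X i ω - p)] = 0 := by
    intro i
    rw [integral_neg, h0, neg_zero]
  have hind : iIndepFun (fun i ω => X i ω - p) μ :=
    hi.comp (fun _ y => y - p) (fun _ => by fun_prop)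
  have hind' : iIndepFun (fun i ω => -(X i ω - p)) μ :=
    hi.comp (fun _ y => -(y - p)) (fun _ => by fun_prop)
  have b1 := maximal_subgaussian (fun i => ((hm i).sub_const p).stronglyMeasurable) hind hs h0 N hN
    (by norm_num) ht
  have b2 := maximal_subgaussian (fun i => ((hm i).sub_const p).neg.stronglyMeasurable) hind' hs'
    h0' N hN (by norm_num) ht
  have hexp : Real.exp (-(t ^ 2 / (2 * N * ((1 / 4 : NNReal) : ℝ)))) =
      Real.exp (-(2 * t ^ 2 / N)) := by
    congr 2
    have : (0 : ℝ) < N := by exact_mod_cast hN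
    push_cast
    field_simp
    ring
  rw [hexp] at b1 b2
  refine (measure_mono ?_).trans ((measure_union_le _ _).trans ((add_le_add b1 b2).trans ?_))
  · rintro ω ⟨q, hq, h⟩
    rcases le_abs.1 h with h | h
    · left; exact ⟨q, hq, by simpa [Finset.sum_sub_distrib] using h⟩
    · right; exact ⟨q, hq, by simpa [Finset.sum_sub_distrib] using h⟩
  · rw [two_mul (ENNReal.ofReal _)]

/-- On the block 2^j ≤ q < 2^(j+1) the threshold is at least √(κ2^j)/2, and the maximal inequality
with N = 2^(j+1) gives exponent κ/4 whatever j is. Only the number of blocks is lost, not the number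
of rounds. -/
theorem concentration_dyadic {X : ℕ → Ω → ℝ} {p κ : ℝ} (hκ : 0 < κ) (hm : ∀ i, Measurable (X i))
    (hi : iIndepFun X μ) (hX : ∀ i ω, X i ω ∈ Set.Icc (0 : ℝ) 1) (hp : ∀ i, μ[X i] = p) (l : ℕ) :
    μ {ω | ∃ q : ℕ, 1 ≤ q ∧ q < 2 ^ l ∧
        √(κ * q) / 2 < |∑ i ∈ Finset.range q, X i ω - q * p|} ≤
      ENNReal.ofReal (2 * l * Real.exp (-(κ / 4))) := by
  have hsub : {ω | ∃ q : ℕ, 1 ≤ q ∧ q < 2 ^ l ∧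
      √(κ * q) / 2 < |∑ i ∈ Finset.range q, X i ω - q * p|} ⊆
      ⋃ j ∈ Finset.range l, {ω | ∃ q ≤ 2 ^ (j + 1),
        √(κ * 2 ^ j) / 2 ≤ |∑ i ∈ Finset.range q, X i ω - q * p|} := by
    rintro ω ⟨q, hq1, hql, h⟩
    simp only [Set.mem_iUnion, Finset.mem_range]
    refine ⟨Nat.log 2 q, Nat.log_lt_of_lt_pow (by omega) hql, q,
      (Nat.lt_pow_succ_log_self (by norm_num) q).le, le_trans ?_ h.le⟩
    have : ((2 ^ Nat.log 2 q : ℕ) : ℝ) ≤ q := by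
      exact_mod_cast Nat.pow_log_le_self 2 (by omega)
    push_cast at this
    gcongr
  refine (measure_mono hsub).trans ((measure_biUnion_finset_le _ _).trans ?_)
  have hb : ∀ j ∈ Finset.range l, μ {ω | ∃ q ≤ 2 ^ (j + 1),
        √(κ * 2 ^ j) / 2 ≤ |∑ i ∈ Finset.range q, X i ω - q * p|} ≤
        ENNReal.ofReal (2 * Real.exp (-(κ / 4))) := by
    intro j _
    refine (maximal_abs_of_mem_Icc hm hi hX hp (2 ^ (j + 1)) (by positivity)
      (t := √(κ * 2 ^ j) / 2) (by positivity)).trans (le_of_eq ?_)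
    rw [ENNReal.ofReal_mul (by norm_num), div_pow, Real.sq_sqrt (by positivity)]
    congr 2
    · simp
    · congr 2
      push_cast
      rw [pow_succ]
      field_simp
      ring
  refine (Finset.sum_le_sum hb).trans (le_of_eq ?_)
  rw [Finset.sum_const, Finset.card_range, nsmul_eq_mul, ← ENNReal.ofReal_natCast,
    ← ENNReal.ofReal_mul (by positivity)]
  congr 1
  ring

end Concentration

/-! ### Concentration of the win counts -/

section Rounds

variable {n s : ℕ}

/-- All sampled pairs have, in the rounds before `2 ^ l`, win counts close to their means. -/
def Concentrated (κ : ℕ) (v : Fin n → ℝ) (E : Fin s → Fin n × Fin n) (R : ℕ × Fin s → Fin n)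
    (l : ℕ) : Prop :=
  ∀ u, ∀ q : ℕ, 1 ≤ q → q < 2 ^ l →
    |(wins R q u (E u).1 : ℝ) -
      q * (Real.exp (v (E u).1) / (Real.exp (v (E u).1) + Real.exp (v (E u).2)))| ≤
        √(κ * q) / 2 ∧
    wins R q u (E u).1 + wins R q u (E u).2 = q

/-- The law of all answers when the sampled pairs are `E`. -/
noncomputable abbrev answerLaw (v : Fin n → ℝ) (E : Fin s → Fin n × Fin n) :
    Measure (ℕ × Fin s → Fin n) :=
  Measure.infinitePi fun i : ℕ × Fin s => compareLaw v (E i.2)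

theorem compareLaw_compl_pair (v : Fin n → ℝ) (p : Fin n × Fin n) :
    compareLaw v p {p.1, p.2}ᶜ = 0 := by
  simp [compareLaw]

theorem compareLaw_fst (v : Fin n → ℝ) {p : Fin n × Fin n} (hp : p.1 ≠ p.2) :
    compareLaw v p {p.1} =
      ENNReal.ofReal (Real.exp (v p.1) / (Real.exp (v p.1) + Real.exp (v p.2))) := by
  simp [compareLaw, hp.symm]

theorem wins_eq_sum (R : ℕ × Fin s → Fin n) (q : ℕ) (u : Fin s) (i : Fin n) :
    (wins R q u i : ℝ) =
      ∑ p ∈ Finset.range q, (({i} : Set (Fin n)).indicator (fun _ => (1 : ℝ)) (R (p, u))) := by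
  simp [wins, Set.indicator_apply]

theorem answerLaw_eval (v : Fin n → ℝ) (E : Fin s → Fin n × Fin n) (i : ℕ × Fin s) :
    (answerLaw v E).map (fun R => R i) = compareLaw v (E i.2) :=
  (measurePreserving_eval_infinitePi (fun i : ℕ × Fin s => compareLaw v (E i.2)) i).map_eq

theorem answerLaw_not_close (κ : ℕ) (hκ : 0 < κ) (v : Fin n → ℝ) (E : Fin s → Fin n × Fin n)
    (u : Fin s) (hu : (E u).1 ≠ (E u).2) (l : ℕ) :
    answerLaw v E {R | ∃ q : ℕ, 1 ≤ q ∧ q < 2 ^ l ∧ √((κ : ℝ) * q) / 2 <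
      |(wins R q u (E u).1 : ℝ) -
        q * (Real.exp (v (E u).1) / (Real.exp (v (E u).1) + Real.exp (v (E u).2)))|} ≤
      ENNReal.ofReal (2 * l * Real.exp (-((κ : ℝ) / 4))) := by
  set g : Fin n → ℝ := ({(E u).1} : Set (Fin n)).indicator (fun _ => (1 : ℝ)) with hg
  have hgm : Measurable g := measurable_of_finite g
  have hind : iIndepFun (fun (p : ℕ) (R : ℕ × Fin s → Fin n) => g (R (p, u))) (answerLaw v E) :=
    (iIndepFun_infinitePi (P := fun i : ℕ × Fin s => compareLaw v (E i.2))
      (X := fun _ => g) (fun _ => hgm)).precomp (g := fun p : ℕ => (p, u))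
        fun a b h => (Prod.mk.inj h).1
  have h01 : ∀ a, g a ∈ Set.Icc (0 : ℝ) 1 := fun a => by
    by_cases h : a = (E u).1 <;> simp [hg, h]
  have hint : ∀ p : ℕ, ∫ R, g (R (p, u)) ∂(answerLaw v E) =
      Real.exp (v (E u).1) / (Real.exp (v (E u).1) + Real.exp (v (E u).2)) := by
    intro p
    have h1 := integral_map (μ := answerLaw v E) (φ := fun R => R (p, u))
      (measurable_pi_apply _).aemeasurable (f := g) hgm.aestronglyMeasurable
    rw [← h1, answerLaw_eval, hg, integral_indicator (MeasurableSet.singleton _)]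
    simp only [integral_const, smul_eq_mul, mul_one, Measure.real]
    rw [Measure.restrict_apply_univ, compareLaw_fst v hu, ENNReal.toReal_ofReal (by positivity)]
  have := concentration_dyadic (μ := answerLaw v E) (κ := (κ : ℝ)) (by exact_mod_cast hκ)
    (fun p => hgm.comp (measurable_pi_apply (p, u))) hind (fun p R => h01 _) hint l
  simp only [wins_eq_sum]
  exact this

theorem answerLaw_wins_add (v : Fin n → ℝ) (E : Fin s → Fin n × Fin n)
    (hE : ∀ u, (E u).1 ≠ (E u).2) :
    ∀ᵐ R ∂(answerLaw v E), ∀ u q, wins R q u (E u).1 + wins R q u (E u).2 = q := by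
  have h1 : ∀ᵐ R ∂(answerLaw v E), ∀ i : ℕ × Fin s, R i = (E i.2).1 ∨ R i = (E i.2).2 := by
    rw [ae_all_iff]
    intro i
    have h2 : ∀ᵐ a ∂((answerLaw v E).map fun R => R i), a = (E i.2).1 ∨ a = (E i.2).2 := by
      rw [answerLaw_eval, ae_iff]
      exact compareLaw_compl_pair v (E i.2)
    exact ae_of_ae_map (measurable_pi_apply i).aemeasurable h2
  filter_upwards [h1] with R hR u q
  rw [wins, wins, ← Finset.card_union_of_disjoint, ← Finset.filter_or, Finset.filter_true_of_mem,
    Finset.card_range]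
  · exact fun p _ => hR (p, u)
  · rw [Finset.disjoint_filter]
    exact fun p _ h h' => hE u (h ▸ h')

theorem answerLaw_not_concentrated (κ : ℕ) (hκ : 0 < κ) (v : Fin n → ℝ)
    (E : Fin s → Fin n × Fin n) (hE : ∀ u, (E u).1 ≠ (E u).2) (l : ℕ) :
    answerLaw v E {R | ¬ Concentrated κ v E R l} ≤
      ENNReal.ofReal (s * (2 * l * Real.exp (-((κ : ℝ) / 4)))) := by
  have h1 : answerLaw v E {R | ¬ Concentrated κ v E R l} ≤
      answerLaw v E (⋃ u : Fin s, {R | ∃ q : ℕ, 1 ≤ q ∧ q < 2 ^ l ∧ √((κ : ℝ) * q) / 2 <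
        |(wins R q u (E u).1 : ℝ) -
          q * (Real.exp (v (E u).1) / (Real.exp (v (E u).1) + Real.exp (v (E u).2)))|}) := by
    refine measure_mono_ae ?_
    filter_upwards [answerLaw_wins_add v E hE] with R hR hbad
    by_contra hcon
    refine hbad fun u q h1 h2 => ⟨?_, hR u q⟩
    by_contra h3
    exact hcon (Set.mem_iUnion.2 ⟨u, q, h1, h2, not_le.1 h3⟩)
  refine h1.trans ((measure_iUnion_le _).trans ?_)
  rw [tsum_fintype]
  refine (Finset.sum_le_sum fun u _ => answerLaw_not_close κ hκ v E u (hE u) l).trans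
    (le_of_eq ?_)
  rw [Finset.sum_const, Finset.card_univ, Fintype.card_fin, nsmul_eq_mul,
    ← ENNReal.ofReal_natCast, ← ENNReal.ofReal_mul (by positivity)]

end Rounds

/-! ### Expansion of the random comparison graph -/

section Sampling

variable {n s : ℕ}

/-- The law of the sampled pairs. -/
noncomputable abbrev pairLaw (W : Finset (Fin n)) (s : ℕ) : Measure (Fin s → Fin n × Fin n) :=
  Measure.pi fun _ : Fin s => uniformOn (W.offDiag : Set (Fin n × Fin n))

theorem isProbabilityMeasure_uniformOn_offDiag {W : Finset (Fin n)} (hW : 2 ≤ W.card) :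
    IsProbabilityMeasure (uniformOn (W.offDiag : Set (Fin n × Fin n))) := by
  refine isProbabilityMeasure_uniformOn W.offDiag.finite_toSet ?_
  obtain ⟨a, ha, b, hb, hab⟩ := Finset.one_lt_card.1 (show 1 < W.card by omega)
  exact ⟨(a, b), by simp [ha, hb, hab]⟩

theorem pairLaw_ae_mem {W : Finset (Fin n)} (hW : 2 ≤ W.card) :
    ∀ᵐ E ∂(pairLaw W s), ∀ u, E u ∈ W.offDiag := by
  have := isProbabilityMeasure_uniformOn_offDiag hW
  rw [ae_all_iff]
  intro u
  have h1 : ∀ᵐ p ∂(uniformOn (W.offDiag : Set (Fin n × Fin n))), p ∈ W.offDiag := by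
    rw [ae_iff, uniformOn_eq_zero_iff W.offDiag.finite_toSet]
    ext p
    simp
  have h2 := (measurePreserving_eval
    (fun _ : Fin s => uniformOn (W.offDiag : Set (Fin n × Fin n))) u).map_eq
  rw [← h2] at h1
  exact ae_of_ae_map (measurable_pi_apply u).aemeasurable h1

/-- One draw hits the product with probability |A||F|/(m(m-1)), and there are mκ independent draws;
1 - y ≤ e^{-y} does the rest. -/
theorem pairLaw_miss {W A F : Finset (Fin n)} (hW : 2 ≤ W.card) (κ : ℕ) (hA : A ⊆ W) (hF : F ⊆ W)
    (hAF : Disjoint A F) :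
    pairLaw W (W.card * κ) {E | ∀ u, E u ∉ A ×ˢ F} ≤
      ENNReal.ofReal (Real.exp (-(κ * (A.card * F.card) / W.card))) := by
  classical
  have := isProbabilityMeasure_uniformOn_offDiag hW
  set m := W.card with hm
  have hm2 : (2 : ℝ) ≤ m := by exact_mod_cast hW
  have hset : {E : Fin (m * κ) → Fin n × Fin n | ∀ u, E u ∉ A ×ˢ F} =
      Set.univ.pi fun _ => (((Finset.univ \ A ×ˢ F : Finset (Fin n × Fin n))) :
        Set (Fin n × Fin n)) := by
    ext E; simp
  have hsub : A ×ˢ F ⊆ W.offDiag := by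
    intro p hp
    rw [Finset.mem_product] at hp
    exact Finset.mem_offDiag.2 ⟨hA hp.1, hF hp.2, fun h =>
      Finset.disjoint_left.1 hAF hp.1 (h ▸ hp.2)⟩
  have hcard : W.offDiag.card = m * m - m := Finset.offDiag_card W
  have hle := Finset.card_le_card hsub
  have hmm : m ≤ m * m := Nat.le_mul_self m
  have hcard' : (W.offDiag.card : ℝ) = m * m - m := by
    rw [hcard, Nat.cast_sub hmm]; push_cast; ring
  have hpos : (0 : ℝ) < m * m - m := by nlinarith
  have hone : uniformOn (W.offDiag : Set (Fin n × Fin n))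
      ((Finset.univ \ A ×ˢ F : Finset (Fin n × Fin n)) : Set (Fin n × Fin n)) =
      ENNReal.ofReal (1 - (A.card * F.card) / (m * m - m)) := by
    have h1 : W.offDiag ∩ (Finset.univ \ A ×ˢ F) = W.offDiag \ A ×ˢ F := by
      ext p; simp
    rw [uniformOn_apply_finset, h1, Finset.card_sdiff_of_subset hsub]
    rw [← ENNReal.ofReal_natCast, ← ENNReal.ofReal_natCast (W.offDiag.card),
      ← ENNReal.ofReal_div_of_pos (by rw [hcard']; exact hpos), Nat.cast_sub hle, hcard',
      Finset.card_product]
    rw [sub_div, div_self hpos.ne', Nat.cast_mul]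
  have h0 : (0 : ℝ) ≤ 1 - (A.card * F.card) / (m * m - m) := by
    rw [sub_nonneg, div_le_one hpos, ← hcard']
    rw [Finset.card_product] at hle
    exact_mod_cast hle
  rw [hset, Measure.pi_pi, Finset.prod_const, Finset.card_univ, Fintype.card_fin, hone,
    ← ENNReal.ofReal_pow h0]
  apply ENNReal.ofReal_le_ofReal
  calc (1 - (A.card * F.card) / ((m : ℝ) * m - m)) ^ (m * κ)
      ≤ (Real.exp (-((A.card * F.card) / ((m : ℝ) * m - m)))) ^ (m * κ) :=
        pow_le_pow_left₀ h0 (Real.one_sub_le_exp_neg _) _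
    _ = Real.exp (-((m * κ) * ((A.card * F.card) / ((m : ℝ) * m - m)))) := by
        rw [← Real.exp_nat_mul]; congr 1; push_cast; ring
    _ ≤ _ := by
        apply Real.exp_le_exp.2
        rw [neg_le_neg_iff]
        have h3 : ((m : ℝ) * κ) * ((A.card * F.card) / ((m : ℝ) * m - m)) =
            κ * (A.card * F.card) / (m - 1) := by
          have : (m : ℝ) - 1 ≠ 0 := by linarith
          have : (m : ℝ) * m - m = m * (m - 1) := by ring
          rw [this]
          field_simp
        rw [h3]
        apply div_le_div_of_nonneg_left (by positivity) (by linarith) (by linarith)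

/-- Positions (in the enumeration `idx`) outside a window of length `b` have many neighbours
inside the window. -/
def Expanding (m b : ℕ) (idx : ℕ → Fin n) (E : Fin s → Fin n × Fin n) : Prop :=
  ∀ lo, lo + b ≤ m → ∀ A D : Finset ℕ, A ⊆ Finset.range m → A.Nonempty →
    Disjoint A (Finset.Ico lo (lo + b)) → D ⊆ Finset.Ico lo (lo + b) → D.card ≤ 3 * A.card →
    b ≤ 4 * (Finset.Ico lo (lo + b) \ D).card →
    ∃ u, ∃ a ∈ A, ∃ f ∈ Finset.Ico lo (lo + b) \ D, E u = (idx a, idx f)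

/-- A union bound over windows, nonempty `A` and sets `D`. Each bad triple has probability at most
z^(|A|+|D|), so the double sum factors into ((1+z)^m - 1)(1+z)^m, which is at most 6mz when mz ≤ 1;
there are at most m + 1 ≤ 2m windows. -/
theorem pairLaw_not_expanding {W : Finset (Fin n)} (hW : 2 ≤ W.card) (κ b : ℕ) {idx : ℕ → Fin n}
    (hinj : Set.InjOn idx (Finset.range W.card)) (hmem : ∀ i < W.card, idx i ∈ W)
    (hz : W.card * Real.exp (-(κ * b / (16 * W.card))) ≤ 1) :
    pairLaw W (W.card * κ) {E | ¬ Expanding W.card b idx E} ≤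
      ENNReal.ofReal (12 * (W.card : ℝ) ^ 2 * Real.exp (-(κ * b / (16 * W.card)))) := by
  classical
  set m := W.card with hm
  set z := Real.exp (-(κ * b / (16 * m))) with hzdef
  have hz0 : 0 < z := Real.exp_pos _
  have hm0 : (0 : ℝ) < m := by
    have : 0 < m := by omega
    exact_mod_cast this
  set P := (Finset.range m).powerset with hP
  have hb : ∀ lo A D, pairLaw W (m * κ) {E | A ⊆ Finset.range m ∧ lo + b ≤ m ∧
      Disjoint A (Finset.Ico lo (lo + b)) ∧ D.card ≤ 3 * A.card ∧
      b ≤ 4 * (Finset.Ico lo (lo + b) \ D).card ∧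
      ∀ u, ∀ a ∈ A, ∀ f ∈ Finset.Ico lo (lo + b) \ D, E u ≠ (idx a, idx f)} ≤
      ENNReal.ofReal (z ^ A.card * z ^ D.card) := by
    intro lo A D
    by_cases hc : A ⊆ Finset.range m ∧ lo + b ≤ m ∧ Disjoint A (Finset.Ico lo (lo + b)) ∧
      D.card ≤ 3 * A.card ∧ b ≤ 4 * (Finset.Ico lo (lo + b) \ D).card
    swap
    · refine le_of_eq_of_le ?_ zero_le
      convert measure_empty (μ := pairLaw W (m * κ)) using 2
      ext E
      simp only [Set.mem_ofPred_eq, Set.mem_empty_iff_false, iff_false]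
      rintro ⟨h1, h2, h3, h4, h5, -⟩
      exact hc ⟨h1, h2, h3, h4, h5⟩
    obtain ⟨h1, h2, h3, h4, h5⟩ := hc
    set F := Finset.Ico lo (lo + b) \ D with hF
    have hFr : F ⊆ Finset.range m := by
      intro f hf
      have := Finset.mem_Ico.1 (Finset.mem_sdiff.1 hf).1
      exact Finset.mem_range.2 (by omega)
    have cA : (A.image idx).card = A.card := Finset.card_image_of_injOn (hinj.mono (by exact_mod_cast h1))
    have cF : (F.image idx).card = F.card :=
      Finset.card_image_of_injOn (hinj.mono (by exact_mod_cast hFr))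
    have hmiss := pairLaw_miss (A := A.image idx) (F := F.image idx) hW κ
      (Finset.image_subset_iff.2 fun a ha => hmem a (Finset.mem_range.1 (h1 ha)))
      (Finset.image_subset_iff.2 fun a ha => hmem a (Finset.mem_range.1 (hFr ha))) (by
        rw [Finset.disjoint_left]
        intro x hx hx'
        obtain ⟨a, ha, rfl⟩ := Finset.mem_image.1 hx
        obtain ⟨f, hf, hfa⟩ := Finset.mem_image.1 hx'
        have : f = a := hinj (hFr hf) (h1 ha) hfa
        exact Finset.disjoint_left.1 h3 ha (this ▸ (Finset.mem_sdiff.1 hf).1))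
    refine (measure_mono ?_).trans (hmiss.trans (ENNReal.ofReal_le_ofReal ?_))
    · rintro E ⟨-, -, -, -, -, h⟩ u hu
      obtain ⟨hu1, hu2⟩ := Finset.mem_product.1 hu
      obtain ⟨a, ha, ha'⟩ := Finset.mem_image.1 hu1
      obtain ⟨f, hf, hf'⟩ := Finset.mem_image.1 hu2
      exact h u a ha f hf (Prod.ext ha'.symm hf'.symm)
    · rw [← pow_add, hzdef, ← Real.exp_nat_mul, cA, cF]
      apply Real.exp_le_exp.2
      rw [mul_neg, neg_le_neg_iff]
      have h4' : (D.card : ℝ) ≤ 3 * A.card := by exact_mod_cast h4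
      have h5' : (b : ℝ) ≤ 4 * F.card := by exact_mod_cast h5
      -- Since |D| ≤ 3|A|, the single factor |A| also pays for the choice of `D`; this and b ≤ 4|F|
      -- produce the 16 in the exponent.
      have h6 : ((A.card + D.card : ℕ) : ℝ) * b ≤ (4 * A.card) * (4 * F.card) := by
        push_cast
        exact mul_le_mul (by linarith) h5' (by positivity) (by positivity)
      rw [mul_div_assoc', div_le_div_iff₀ (by positivity) hm0]
      have hk : (0 : ℝ) ≤ κ * m := by positivity
      nlinarith [mul_le_mul_of_nonneg_left h6 hk]
  have hsub : {E : Fin (m * κ) → Fin n × Fin n | ¬ Expanding m b idx E} ⊆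
      ⋃ lo ∈ Finset.range (m + 1), ⋃ A ∈ P.erase ∅, ⋃ D ∈ P, {E | A ⊆ Finset.range m ∧
      lo + b ≤ m ∧ Disjoint A (Finset.Ico lo (lo + b)) ∧ D.card ≤ 3 * A.card ∧
      b ≤ 4 * (Finset.Ico lo (lo + b) \ D).card ∧
      ∀ u, ∀ a ∈ A, ∀ f ∈ Finset.Ico lo (lo + b) \ D, E u ≠ (idx a, idx f)} := by
    intro E hE
    simp only [Set.mem_ofPred_eq, Expanding] at hE
    push Not at hE
    obtain ⟨lo, h1, A, D, h2, h3, h4, h5, h6, h7, h8⟩ := hE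
    simp only [Set.mem_iUnion]
    refine ⟨lo, Finset.mem_range.2 (by omega), A, Finset.mem_erase.2
      ⟨h3.ne_empty, Finset.mem_powerset.2 h2⟩, D, Finset.mem_powerset.2 fun x hx => ?_,
      h2, h1, h4, h6, h7, h8⟩
    have := Finset.mem_Ico.1 (h5 hx)
    exact Finset.mem_range.2 (by omega)
  have hpow : ∑ A ∈ P, z ^ A.card = (1 + z) ^ m := by
    have := Finset.sum_pow_mul_eq_add_pow z 1 (Finset.range m)
    simpa [add_comm] using this
  have hpow' : ∑ A ∈ P.erase ∅, z ^ A.card = (1 + z) ^ m - 1 := by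
    rw [← hpow, ← Finset.sum_erase_add P _ (Finset.empty_mem_powerset _)]
    simp
  have hexp : (1 + z) ^ m ≤ 1 + 2 * (m * z) := by
    calc (1 + z) ^ m ≤ Real.exp z ^ m :=
          pow_le_pow_left₀ (by positivity) (by linarith [Real.add_one_le_exp z]) _
      _ = Real.exp (m * z) := (Real.exp_nat_mul _ _).symm
      _ ≤ _ := by
        have h := Real.abs_exp_sub_one_le (x := m * z)
          (by rw [abs_of_nonneg (by positivity)]; exact hz)
        rw [abs_of_nonneg (a := (m : ℝ) * z) (by positivity)] at h
        linarith [(abs_le.1 h).2]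
  have h1m : (1 : ℝ) ≤ (1 + z) ^ m := one_le_pow₀ (by linarith)
  refine (measure_mono hsub).trans ((measure_biUnion_finset_le _ _).trans ?_)
  have hin : ∀ lo ∈ Finset.range (m + 1), pairLaw W (m * κ) (⋃ A ∈ P.erase ∅, ⋃ D ∈ P,
      {E | A ⊆ Finset.range m ∧
      lo + b ≤ m ∧ Disjoint A (Finset.Ico lo (lo + b)) ∧ D.card ≤ 3 * A.card ∧
      b ≤ 4 * (Finset.Ico lo (lo + b) \ D).card ∧
      ∀ u, ∀ a ∈ A, ∀ f ∈ Finset.Ico lo (lo + b) \ D, E u ≠ (idx a, idx f)}) ≤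
      ENNReal.ofReal (((1 + z) ^ m - 1) * (1 + z) ^ m) := by
    intro lo _
    rw [← hpow', ← hpow, Finset.sum_mul_sum, ENNReal.ofReal_sum_of_nonneg
      (fun _ _ => Finset.sum_nonneg fun _ _ => by positivity)]
    refine (measure_biUnion_finset_le _ _).trans (Finset.sum_le_sum fun A _ => ?_)
    rw [ENNReal.ofReal_sum_of_nonneg (fun _ _ => by positivity)]
    exact (measure_biUnion_finset_le _ _).trans (Finset.sum_le_sum fun D _ => hb lo A D)
  refine (Finset.sum_le_sum hin).trans ?_
  rw [Finset.sum_const, Finset.card_range, nsmul_eq_mul, ← ENNReal.ofReal_natCast,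
    ← ENNReal.ofReal_mul (by positivity)]
  apply ENNReal.ofReal_le_ofReal
  have h3 : (1 + z) ^ m ≤ 3 := by linarith
  have : ((1 + z) ^ m - 1) * (1 + z) ^ m ≤ (2 * (m * z)) * 3 :=
    mul_le_mul (by linarith) h3 (by linarith) (by positivity)
  have hm1 : ((m + 1 : ℕ) : ℝ) ≤ 2 * m := by
    have : m + 1 ≤ 2 * m := by omega
    exact_mod_cast this
  calc ((m + 1 : ℕ) : ℝ) * (((1 + z) ^ m - 1) * (1 + z) ^ m)
      ≤ (2 * m) * ((2 * (m * z)) * 3) := by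
        apply mul_le_mul hm1 this _ (by positivity)
        exact mul_nonneg (by linarith) (by linarith)
    _ = 12 * (m : ℝ) ^ 2 * z := by ring


end Sampling

/-! ### Short increasing paths from expansion -/

section Paths

variable {n s : ℕ}

/-- The positions `p` and `q` are joined by a sampled pair. -/
def Joined (idx : ℕ → Fin n) (E : Fin s → Fin n × Fin n) (p q : ℕ) : Prop :=
  ∃ u, E u = (idx p, idx q) ∨ E u = (idx q, idx p)

theorem Joined.symm {idx : ℕ → Fin n} {E : Fin s → Fin n × Fin n} {p q : ℕ}
    (h : Joined idx E p q) : Joined idx E q p := by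
  obtain ⟨u, h⟩ := h
  exact ⟨u, h.symm⟩

/-- There is a path of length `d` along increasing positions. -/
def IncPath (idx : ℕ → Fin n) (E : Fin s → Fin n × Fin n) : ℕ → ℕ → ℕ → Prop
  | 0, i, j => i = j
  | d + 1, i, j => ∃ k, i < k ∧ Joined idx E i k ∧ IncPath idx E d k j

theorem IncPath.trans {idx : ℕ → Fin n} {E : Fin s → Fin n × Fin n} {d e i j k : ℕ}
    (h : IncPath idx E d i j) (h' : IncPath idx E e j k) : IncPath idx E (d + e) i k := by
  induction d generalizing i with
  | zero => rw [Nat.zero_add]; exact (show i = j from h) ▸ h'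
  | succ d ih =>
    obtain ⟨l, h1, h2, h3⟩ := h
    rw [Nat.add_right_comm]
    exact ⟨l, h1, h2, ih h3⟩

theorem IncPath.single {idx : ℕ → Fin n} {E : Fin s → Fin n × Fin n} {i j : ℕ} (hij : i < j)
    (h : Joined idx E i j) : IncPath idx E 1 i j := ⟨j, hij, h, rfl⟩

theorem IncPath.exists_seq {idx : ℕ → Fin n} {E : Fin s → Fin n × Fin n} {d i j : ℕ}
    (h : IncPath idx E d i j) : ∃ x : ℕ → ℕ, x 0 = i ∧ x d = j ∧
      ∀ r < d, x r < x (r + 1) ∧ Joined idx E (x r) (x (r + 1)) := by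
  induction d generalizing i with
  | zero => exact ⟨fun _ => i, rfl, h, by simp⟩
  | succ d ih =>
    obtain ⟨k, h1, h2, h3⟩ := h
    obtain ⟨x, x0, xd, hx⟩ := ih h3
    refine ⟨fun r => r.casesOn i x, rfl, xd, ?_⟩
    rintro (_ | r) hr
    · simpa [x0] using ⟨h1, h2⟩
    · exact hx r (by omega)

variable {m b : ℕ} {idx : ℕ → Fin n} {E : Fin s → Fin n × Fin n}

/-- Apply expansion with `D` equal to the neighbourhood of `A` in the window: an edge leaving it is
a contradiction, so the neighbourhood is too large for `D`. Either it has tripled or it fills more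
than three quarters of the window. -/
theorem Expanding.grow (hE : Expanding m b idx E) (hb : 1 ≤ b) {lo : ℕ} (hlo : lo + b ≤ m)
    {A : Finset ℕ} (hA : A ⊆ Finset.range m) (hAne : A.Nonempty)
    (hdis : Disjoint A (Finset.Ico lo (lo + b))) {t : ℕ}
    (hcard : 3 ^ t ≤ A.card ∨ 3 * b < 4 * A.card) :
    ∃ F ⊆ Finset.Ico lo (lo + b), F.Nonempty ∧ (3 ^ (t + 1) ≤ F.card ∨ 3 * b < 4 * F.card) ∧
      ∀ f ∈ F, ∃ a ∈ A, Joined idx E a f := by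
  classical
  set F := (Finset.Ico lo (lo + b)).filter fun f => ∃ a ∈ A, Joined idx E a f with hF
  have hsub : F ⊆ Finset.Ico lo (lo + b) := Finset.filter_subset _ _
  have hFc : 3 * A.card < F.card ∨ 3 * b < 4 * F.card := by
    by_contra hcon
    push Not at hcon
    have h1 := Finset.card_sdiff_of_subset hsub
    rw [Nat.card_Ico] at h1
    obtain ⟨u, a, ha, f, hf, huf⟩ := hE lo hlo A F hA hAne hdis hsub hcon.1 (by omega)
    rw [Finset.mem_sdiff] at hf
    exact hf.2 (Finset.mem_filter.2 ⟨hf.1, a, ha, u, Or.inl huf⟩)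
  refine ⟨F, hsub, ?_, ?_, fun f hf => (Finset.mem_filter.1 hf).2⟩
  · rw [← Finset.card_pos]
    omega
  · rw [pow_succ]
    omega

theorem Expanding.forward (hE : Expanding m b idx E) (hb : 1 ≤ b) (i t : ℕ)
    (ht : i + 1 + t * b ≤ m) :
    ∃ F ⊆ Finset.range (i + 1 + t * b), F.Nonempty ∧ (3 ^ t ≤ F.card ∨ 3 * b < 4 * F.card) ∧
      ∀ f ∈ F, IncPath idx E t i f := by
  induction t with
  | zero => exact ⟨{i}, by simp, by simp, by simp, by simp [IncPath]⟩
  | succ t ih =>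
    have he : i + 1 + (t + 1) * b = i + 1 + t * b + b := by ring
    obtain ⟨A, hA, hAne, hAc, hAp⟩ := ih (by omega)
    obtain ⟨F, hF, hFne, hFc, hFp⟩ := hE.grow hb (lo := i + 1 + t * b) (by omega)
      (hA.trans (Finset.range_subset_range.2 (by omega))) hAne (by
        rw [Finset.disjoint_left]
        intro x hx hx'
        have := Finset.mem_range.1 (hA hx)
        have := (Finset.mem_Ico.1 hx').1
        omega) hAc
    refine ⟨F, fun f hf => ?_, hFne, hFc, fun f hf => ?_⟩
    · have := Finset.mem_Ico.1 (hF hf)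
      exact Finset.mem_range.2 (by omega)
    · obtain ⟨a, ha, haf⟩ := hFp f hf
      refine (hAp a ha).trans (IncPath.single ?_ haf)
      have := Finset.mem_Ico.1 (hF hf)
      have := Finset.mem_range.1 (hA ha)
      omega

/-- The mirror image of `Expanding.forward`. At step 0 the window starts at `j` itself, so the bound
f ≤ j is carried along to keep the sets inside the range. -/
theorem Expanding.backward (hE : Expanding m b idx E) (hb : 1 ≤ b) (j t : ℕ) (hj : j < m)
    (ht : t * b ≤ j) :
    ∃ F ⊆ Finset.Ico (j - t * b) (j - t * b + b), (∀ f ∈ F, f ≤ j) ∧ F.Nonempty ∧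
      (3 ^ t ≤ F.card ∨ 3 * b < 4 * F.card) ∧ ∀ f ∈ F, IncPath idx E t f j := by
  induction t with
  | zero => exact ⟨{j}, by simp; omega, by simp, by simp, by simp, by simp [IncPath]⟩
  | succ t ih =>
    have he : (t + 1) * b = t * b + b := by ring
    obtain ⟨A, hA, hAj, hAne, hAc, hAp⟩ := ih (by omega)
    obtain ⟨F, hF, hFne, hFc, hFp⟩ := hE.grow hb (lo := j - (t + 1) * b) (by omega)
      (fun a ha => Finset.mem_range.2 (by have := hAj a ha; omega)) hAne (by
        rw [Finset.disjoint_left]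
        intro x hx hx'
        have := Finset.mem_Ico.1 (hA hx)
        have := (Finset.mem_Ico.1 hx').2
        omega) hAc
    refine ⟨F, hF, fun f hf => ?_, hFne, hFc, fun f hf => ?_⟩
    · have := Finset.mem_Ico.1 (hF hf)
      omega
    · obtain ⟨a, ha, haf⟩ := hFp f hf
      have h1 := Finset.mem_Ico.1 (hF hf)
      have h2 := Finset.mem_Ico.1 (hA ha)
      exact ⟨a, by omega, haf.symm, hAp a ha⟩

/-- After L steps the sets reached from both ends are large because b ≤ 3^L, and one more use of
expansion joins them. -/
theorem Expanding.incPath (hE : Expanding m b idx E) (hb : 1 ≤ b) {L i j : ℕ} (hj : j < m)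
    (hL : b ≤ 3 ^ L) (hij : i + 2 * (L * b) < j) (hL1 : 1 ≤ L) :
    IncPath idx E (2 * L + 1) i j := by
  obtain ⟨F, hF, hFne, hFc, hFp⟩ := hE.forward hb i L (by omega)
  obtain ⟨G, hG, hGj, hGne, hGc, hGp⟩ := hE.backward hb j L hj (by omega)
  have hLb : b ≤ L * b := Nat.le_mul_of_pos_left b hL1
  have h1 := Finset.card_sdiff_of_subset hG
  rw [Nat.card_Ico] at h1
  have h2 : Finset.Ico (j - L * b) (j - L * b + b) \
      (Finset.Ico (j - L * b) (j - L * b + b) \ G) = G :=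
    sdiff_sdiff_eq_self hG
  -- Excluding the complement of `G` in its window forces the edge to land in `G`; that complement
  -- has fewer than b/4 elements, hence at most 3|F|.
  obtain ⟨u, a, ha, f, hf, huf⟩ := hE (j - L * b) (by omega) F
    (Finset.Ico (j - L * b) (j - L * b + b) \ G)
    (hF.trans (Finset.range_subset_range.2 (by omega))) hFne (by
      rw [Finset.disjoint_left]
      intro x hx hx'
      have := Finset.mem_range.1 (hF hx)
      have := (Finset.mem_Ico.1 hx').1
      omega) Finset.sdiff_subset (by omega) (by rw [h2]; omega)
  rw [h2] at hf
  have h3 := Finset.mem_range.1 (hF ha)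
  have h4 := Finset.mem_Ico.1 (hG hf)
  have := ((hFp a ha).trans (IncPath.single (by omega) ⟨u, Or.inl huf⟩)).trans (hGp f hf)
  rwa [show L + 1 + L = 2 * L + 1 by ring] at this

/-- Windows of length one make the graph complete; this serves the sets too small for windows of
length m/(16L). -/
theorem Expanding.joined (hE : Expanding m 1 idx E) {i j : ℕ} (hi : i < m) (hj : j < m)
    (hij : i ≠ j) : Joined idx E i j := by
  obtain ⟨u, a, ha, f, hf, huf⟩ := hE j (by omega) {i} ∅ (by simpa using hi) (by simp)
    (by simpa using hij) (by simp) (by simp) (by simp)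
  simp only [Finset.mem_singleton] at ha
  simp only [Finset.sdiff_empty, Finset.mem_Ico] at hf
  obtain rfl : f = j := by omega
  exact ⟨u, Or.inl (ha ▸ huf)⟩

/-- Positions of distance more than an eighth of the total are joined by a short increasing
path. -/
theorem Expanding.short_path {L : ℕ} (hE : Expanding m (max 1 (m / (16 * L))) idx E)
    (hL1 : 1 ≤ L) (hL : m ≤ 3 ^ L) {i j : ℕ} (hj : j < m) (hij : i < j) (h8 : m < 8 * (j - i)) :
    ∃ d ≤ 2 * L + 1, IncPath idx E d i j := by
  rcases Nat.lt_or_ge m (16 * L) with h | h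
  · rw [Nat.div_eq_of_lt h] at hE
    exact ⟨1, by omega, IncPath.single hij (Expanding.joined hE (by omega) hj hij.ne)⟩
  · have h1 : 1 ≤ m / (16 * L) := (Nat.one_le_div_iff (by omega)).2 h
    rw [max_eq_right h1] at hE
    have h2 : m / (16 * L) * (16 * L) ≤ m := Nat.div_mul_le_self _ _
    refine ⟨2 * L + 1, le_rfl, hE.incPath h1 hj ((Nat.div_le_self _ _).trans hL) ?_ hL1⟩
    have : m / (16 * L) * (16 * L) = 8 * (2 * (L * (m / (16 * L)))) := by ring
    omega

end Paths

/-! ### Labels versus true score ratios -/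

section Labels

theorem edgeLabel_up_iff {κ q a b : ℕ} :
    (edgeLabel κ q a b = .approx ∨ edgeLabel κ q a b = .ge ∨ edgeLabel κ q a b = .gt) ↔
      (b : ℝ) ≤ (1 + 4 * √((κ : ℝ) / q)) * a := by
  have hx : 0 ≤ √((κ : ℝ) / q) := Real.sqrt_nonneg _
  have ha : (0 : ℝ) ≤ a := by positivity
  have hb : (0 : ℝ) ≤ b := by positivity
  have hxa := mul_nonneg hx ha
  have hxb := mul_nonneg hx hb
  have hk : (0 : ℝ) ≤ κ * √((κ : ℝ) / q) * b := by positivity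
  unfold edgeLabel
  simp only
  split_ifs with h1 h2 h3 h4
  · simp only [or_true, true_iff]
    linarith
  · simp only [true_or, or_true, true_iff]
    linarith
  · simpa using h3
  · simpa using h3
  · simpa using h3

theorem edgeLabel_gt_iff {κ q a b : ℕ} :
    edgeLabel κ q a b = .gt ↔ (1 + 32 * κ * √((κ : ℝ) / q)) * b ≤ (a : ℝ) := by
  unfold edgeLabel
  simp only
  split_ifs <;> simp_all

/-- The observed counts `a, b` are close to proportional to `s, t`. -/
def CountsClose (x a b s t : ℝ) : Prop := |a * t - b * s| ≤ x / 2 * (a + b) * (s + t)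

theorem CountsClose.symm {x a b s t : ℝ} (h : CountsClose x a b s t) : CountsClose x b a t s := by
  unfold CountsClose at *
  rw [abs_sub_comm]
  linarith

/-- The deviation √(κq)/2 equals qx/2, and at - bs is the deviation of `a` from its mean times s +
t. -/
theorem countsClose_of_abs_le {κ q a b : ℕ} {s t : ℝ} (hs : 0 < s) (ht : 0 < t) (hq : 0 < q)
    (hab : a + b = q) (h : |(a : ℝ) - q * (s / (s + t))| ≤ √(κ * q) / 2) :
    CountsClose √((κ : ℝ) / q) a b s t := by
  have hq' : (0 : ℝ) < q := by exact_mod_cast hq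
  have hab' : (a : ℝ) + b = q := by exact_mod_cast hab
  have hst : 0 < s + t := by linarith
  have h1 : √((κ : ℝ) * q) = q * √((κ : ℝ) / q) := by
    have : (κ : ℝ) * q = q ^ 2 * (κ / q) := by field_simp
    rw [this, Real.sqrt_mul (by positivity), Real.sqrt_sq hq'.le]
  have h2 : (a : ℝ) * t - b * s = ((a : ℝ) - q * (s / (s + t))) * (s + t) := by
    rw [← hab']
    field_simp
    ring
  unfold CountsClose
  rw [h2, abs_mul, abs_of_pos hst, hab']
  rw [h1] at h
  calc _ ≤ (q * √((κ : ℝ) / q) / 2) * (s + t) := by gcongr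
    _ = _ := by ring

variable {x a b s t : ℝ}

/-- This and the next three lemmas translate between counts and scores in both directions, at scale
x for the weak labels and at y = κx for the label >. The constants 4, 10 and 20, 32, 40 leave room
for the sampling error and for the quadratic terms, which x, y ≤ 1/100 makes negligible. -/
theorem CountsClose.count_le (h : CountsClose x a b s t) (hx : 0 ≤ x) (hx1 : x ≤ 1 / 100)
    (ha : 0 ≤ a) (hb : 0 ≤ b) (hs : 0 < s) (hst : t ≤ s) : b ≤ (1 + 4 * x) * a := by
  have h1 := (abs_le.1 h).1
  have h2 : s * (b - a) ≤ s * (x * (a + b)) := by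
    nlinarith [mul_nonneg ha (sub_nonneg.2 hst),
      mul_nonneg (mul_nonneg hx (add_nonneg ha hb)) (sub_nonneg.2 hst)]
  have h3 := le_of_mul_le_mul_left h2 hs
  nlinarith [mul_nonneg hx ha, mul_nonneg hx (mul_nonneg hx ha)]

theorem CountsClose.rate_le (h : CountsClose x a b s t) (hx : 0 ≤ x) (hx1 : x ≤ 1 / 100)
    (ha : 0 ≤ a) (hab : 0 < a + b) (hs : 0 < s) (ht : 0 < t) (hle : b ≤ (1 + 4 * x) * a) :
    t ≤ (1 + 10 * x) * s := by
  have ha' : 0 < a := by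
    rcases ha.lt_or_eq with h | h
    · exact h
    · subst h; linarith
  have h1 := (abs_le.1 h).2
  have h2 : a * (t - (1 + 4 * x) * s) ≤ a * ((x + 2 * x ^ 2) * (s + t)) := by
    nlinarith [mul_nonneg (sub_nonneg.2 hle) hs.le,
      mul_nonneg (mul_nonneg hx (add_pos hs ht).le) (sub_nonneg.2 hle)]
  have h3 := le_of_mul_le_mul_left h2 ha'
  nlinarith [mul_nonneg hx hs.le, mul_nonneg hx ht.le, mul_nonneg hx (mul_nonneg hx hs.le),
    mul_nonneg hx (mul_nonneg hx ht.le)]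

theorem CountsClose.rate_gt {y : ℝ} (h : CountsClose x a b s t) (hx : 0 ≤ x) (hxy : x ≤ y)
    (hy1 : y ≤ 1 / 100) (ha : 0 ≤ a) (hb : 0 ≤ b) (hab : 0 < a + b) (hs : 0 < s) (ht : 0 < t)
    (hle : (1 + 32 * y) * b ≤ a) : (1 + 20 * y) * t ≤ s := by
  have hy : 0 ≤ y := hx.trans hxy
  have ha' : 0 < a := by
    rcases ha.lt_or_eq with h | h
    · exact h
    · subst h; nlinarith
  have h1 := (abs_le.1 h).2
  have h2 : a * ((1 + 32 * y) * t - s) ≤ a * (x / 2 * (2 + 32 * y) * (s + t)) := by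
    have e1 := mul_le_mul_of_nonneg_right hle hs.le
    have e2 := mul_le_mul_of_nonneg_left h1 (show 0 ≤ 1 + 32 * y by linarith)
    have e3 := mul_le_mul_of_nonneg_left hle (mul_nonneg hx (add_pos hs ht).le)
    nlinarith
  have h3 := le_of_mul_le_mul_left h2 ha'
  have e1 : x / 2 * (2 + 32 * y) * (s + t) ≤ 1.16 * y * (s + t) := by
    apply mul_le_mul_of_nonneg_right _ (add_pos hs ht).le
    nlinarith
  nlinarith [mul_nonneg hy hs.le, mul_nonneg hy ht.le, mul_nonneg hy (mul_nonneg hy hs.le),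
    mul_nonneg hy (mul_nonneg hy ht.le)]

theorem CountsClose.count_gt {y : ℝ} (h : CountsClose x a b s t) (hx : 0 ≤ x) (hxy : x ≤ y)
    (hy1 : y ≤ 1 / 100) (ha : 0 ≤ a) (hb : 0 ≤ b) (hs : 0 < s)
    (hle : (1 + 40 * y) * t ≤ s) : (1 + 32 * y) * b ≤ a := by
  have hy : 0 ≤ y := hx.trans hxy
  have h1 := (abs_le.1 h).1
  have h2 : s * ((1 + 40 * y) * b - a) ≤ s * (x / 2 * (2 + 40 * y) * (a + b)) := by
    have e1 := mul_le_mul_of_nonneg_right hle ha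
    have e2 := mul_le_mul_of_nonneg_left h1 (show 0 ≤ 1 + 40 * y by linarith)
    have e3 := mul_le_mul_of_nonneg_left hle (mul_nonneg hx (add_nonneg ha hb))
    nlinarith
  have h3 := le_of_mul_le_mul_left h2 hs
  have e1 : x / 2 * (2 + 40 * y) * (a + b) ≤ 1.2 * y * (a + b) := by
    apply mul_le_mul_of_nonneg_right _ (add_nonneg ha hb)
    nlinarith
  nlinarith [mul_nonneg hy ha, mul_nonneg hy hb, mul_nonneg hy (mul_nonneg hy ha),
    mul_nonneg hy (mul_nonneg hy hb)]

end Labels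

/-! ### Strict dominance: soundness and completeness -/

section Soundness

variable {n s κ l q : ℕ} {v : Fin n → ℝ} {E : Fin s → Fin n × Fin n} {R : ℕ × Fin s → Fin n}

theorem Concentrated.close (hR : Concentrated κ v E R l) (hq : 1 ≤ q) (hql : q < 2 ^ l) {u : Fin s}
    {i j : Fin n} (hu : E u = (i, j) ∨ E u = (j, i)) :
    CountsClose √((κ : ℝ) / q) (wins R q u i) (wins R q u j) (Real.exp (v i)) (Real.exp (v j)) ∧
      wins R q u i + wins R q u j = q := by
  obtain ⟨h1, h2⟩ := hR u q hq hql
  have h3 := countsClose_of_abs_le (Real.exp_pos _) (Real.exp_pos _) hq h2 h1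
  rcases hu with hu | hu <;> rw [hu] at h3 h2
  · exact ⟨h3, h2⟩
  · exact ⟨h3.symm, by rw [add_comm]; exact h2⟩

theorem mul_sqrt_le {κ q : ℕ} (hq : 1 ≤ q) (h : 10000 * κ ^ 3 ≤ q) :
    (κ : ℝ) * √((κ : ℝ) / q) ≤ 1 / 100 := by
  have hq' : (0 : ℝ) < q := by exact_mod_cast hq
  have h' : (10000 : ℝ) * κ ^ 3 ≤ q := by exact_mod_cast h
  rw [← Real.sqrt_sq (show (0 : ℝ) ≤ κ by positivity), ← Real.sqrt_mul (by positivity),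
    Real.sqrt_sq (show (0 : ℝ) ≤ κ by positivity)]
  apply Real.sqrt_le_iff.2 ⟨by norm_num, ?_⟩
  rw [mul_div_assoc', div_le_iff₀ hq']
  nlinarith

/-- Along the path the score can rise by a factor of at most (1 + 10x)^κ, which is less than 1 +
20κx, while the edge labelled > lowers it by at least 1 + 20κx. -/
theorem StrictlyAbove.lt (hR : Concentrated κ v E R l) (hκ : 1 ≤ κ) (hq : 10000 * κ ^ 3 ≤ q)
    (hql : q < 2 ^ l) {i j : Fin n} (h : StrictlyAbove κ E R q i j) : v j < v i := by
  have hκ3 : 1 ≤ κ ^ 3 := Nat.one_le_pow _ _ hκ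
  have hq1 : 1 ≤ q := by omega
  have hy := mul_sqrt_le hq1 hq
  have hx0 : 0 < √((κ : ℝ) / q) := Real.sqrt_pos.2 (by positivity)
  set x := √((κ : ℝ) / q) with hx
  have hκ' : (1 : ℝ) ≤ κ := by exact_mod_cast hκ
  have hxy : x ≤ κ * x := le_mul_of_one_le_left hx0.le hκ'
  obtain ⟨d, p, e, hd, p0, pd, hstep, r₀, hr₀, hgt⟩ := h
  set w : ℕ → ℝ := fun r => Real.exp (v (p r)) with hw
  have hwpos : ∀ r, 0 < w r := fun r => Real.exp_pos _
  have hle : ∀ r < d, w (r + 1) ≤ (1 + 10 * x) * w r := by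
    intro r hr
    have h1 : (E (e r) = (p r, p (r + 1)) ∨ E (e r) = (p (r + 1), p r)) ∧
        (edgeLabel κ q (wins R q (e r) (p r)) (wins R q (e r) (p (r + 1))) = .approx ∨
        edgeLabel κ q (wins R q (e r) (p r)) (wins R q (e r) (p (r + 1))) = .ge ∨
        edgeLabel κ q (wins R q (e r) (p r)) (wins R q (e r) (p (r + 1))) = .gt) := by
      rcases hstep r hr with h | h | h
      · exact ⟨h.1, Or.inl h.2⟩
      · exact ⟨h.1, Or.inr (Or.inl h.2)⟩
      · exact ⟨h.1, Or.inr (Or.inr h.2)⟩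
    obtain ⟨c1, c2⟩ := hR.close hq1 hql h1.1
    refine c1.rate_le hx0.le (hxy.trans hy) (by positivity) ?_ (hwpos _) (hwpos _)
      (edgeLabel_up_iff.1 h1.2)
    have : 0 < wins R q (e r) (p r) + wins R q (e r) (p (r + 1)) := by omega
    exact_mod_cast this
  have hstrict : (1 + 20 * (κ * x)) * w (r₀ + 1) ≤ w r₀ := by
    obtain ⟨c1, c2⟩ := hR.close hq1 hql hgt.1
    refine c1.rate_gt hx0.le hxy hy (by positivity) (by positivity) ?_ (hwpos _) (hwpos _) ?_
    · have : 0 < wins R q (e r₀) (p r₀) + wins R q (e r₀) (p (r₀ + 1)) := by omega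
      exact_mod_cast this
    · have := edgeLabel_gt_iff.1 hgt.2
      rwa [mul_assoc (32 : ℝ)] at this
  have h1 : ∀ r ≤ d, w r ≤ (1 + 10 * x) ^ r * w 0 := by
    intro r
    induction r with
    | zero => simp
    | succ r ih =>
      intro hr
      calc w (r + 1) ≤ (1 + 10 * x) * w r := hle r hr
        _ ≤ (1 + 10 * x) * ((1 + 10 * x) ^ r * w 0) := by
          gcongr
          exact ih (by omega)
        _ = _ := by ring
  -- The factor gained at the strict edge is carried to the end of the path; crediting that edge
  -- with a rise as well is wasteful but makes the exponent uniform.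
  have h2 : ∀ r, r₀ + 1 ≤ r → r ≤ d → (1 + 20 * (κ * x)) * w r ≤ (1 + 10 * x) ^ r * w 0 := by
    intro r hr
    induction r, hr using Nat.le_induction with
    | base =>
      intro _
      refine hstrict.trans ((h1 r₀ hr₀.le).trans ?_)
      have := hwpos 0
      gcongr
      · linarith
      · omega
    | succ r hr ih =>
      intro hrd
      calc (1 + 20 * (κ * x)) * w (r + 1) ≤ (1 + 20 * (κ * x)) * ((1 + 10 * x) * w r) := by
            gcongr
            exact hle r hrd
        _ = (1 + 10 * x) * ((1 + 20 * (κ * x)) * w r) := by ring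
        _ ≤ (1 + 10 * x) * ((1 + 10 * x) ^ r * w 0) :=
          mul_le_mul_of_nonneg_left (ih (by omega)) (by positivity)
        _ = _ := by ring
  have h3 := h2 d hr₀ le_rfl
  have hyp : 0 < κ * x := by positivity
  have h4 : (1 + 10 * x) ^ d < 1 + 20 * (κ * x) := by
    calc (1 + 10 * x) ^ d ≤ (1 + 10 * x) ^ κ := pow_le_pow_right₀ (by linarith) hd
      _ ≤ Real.exp (10 * x) ^ κ :=
        pow_le_pow_left₀ (by positivity) (by linarith [Real.add_one_le_exp (10 * x)]) _
      _ = Real.exp (10 * (κ * x)) := by rw [← Real.exp_nat_mul]; congr 1; ring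
      _ < _ := by
        have := Real.abs_exp_sub_one_sub_id_le (x := 10 * (κ * x))
          (by rw [abs_of_pos (by positivity)]; linarith)
        have := (abs_le.1 this).2
        nlinarith
  have h5 : w d < w 0 := by
    have h6 : (1 + 20 * (κ * x)) * w d < (1 + 20 * (κ * x)) * w 0 :=
      h3.trans_lt (mul_lt_mul_of_pos_right h4 (hwpos 0))
    exact lt_of_mul_lt_mul_left h6 (by positivity)
  have h7 := Real.exp_lt_exp.1 h5
  rwa [p0, pd] at h7

/-- Increasing positions mean decreasing utility, so every edge has an upward label. If none were >,
each would drop by less than 1 + 40κx, and the whole path by less than 1 + 80κ²x, contrary to the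
gap. -/
theorem IncPath.strictlyAbove {idx : ℕ → Fin n} (hR : Concentrated κ v E R l) (hκ : 1 ≤ κ)
    (hidx : Antitone fun i => v (idx i)) (hq : 10000 * κ ^ 3 ≤ q) (hql : q < 2 ^ l)
    {d i j : ℕ} (hp : IncPath idx E d i j) (hd : d ≤ κ) {w : ℝ} (hw : 1 ≤ w)
    (hqw : 6400 * (κ : ℝ) ^ 5 * w ≤ q)
    (hgap : Real.exp (v (idx j)) ^ 2 ≤
      w * (Real.exp (v (idx i)) - Real.exp (v (idx j))) ^ 2)
    (hij : v (idx j) ≤ v (idx i)) :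
    StrictlyAbove κ E R q (idx i) (idx j) := by
  have hκ3 : 1 ≤ κ ^ 3 := Nat.one_le_pow _ _ hκ
  have hq1 : 1 ≤ q := by omega
  have hy := mul_sqrt_le hq1 hq
  have hx0 : 0 < √((κ : ℝ) / q) := Real.sqrt_pos.2 (by positivity)
  have hxsq : √((κ : ℝ) / q) ^ 2 = κ / q := Real.sq_sqrt (by positivity)
  set x := √((κ : ℝ) / q) with hx
  have hκ' : (1 : ℝ) ≤ κ := by exact_mod_cast hκ
  have hq' : (0 : ℝ) < q := by exact_mod_cast hq1
  have hxy : x ≤ κ * x := le_mul_of_one_le_left hx0.le hκ'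
  have hxsq' : q * x ^ 2 = κ := by rw [hxsq]; field_simp
  -- The constant 6400 is 80²: the round bound says exactly that z = 80κ²x is at most 1/√w, the
  -- relative gap granted by `hgap`.
  have hz : w * (80 * κ ^ 2 * x) ^ 2 ≤ 1 := by
    have h1 : q * (w * (80 * κ ^ 2 * x) ^ 2) ≤ q * 1 := by
      calc q * (w * (80 * κ ^ 2 * x) ^ 2) = 6400 * κ ^ 4 * w * (q * x ^ 2) := by ring
        _ = 6400 * (κ : ℝ) ^ 5 * w := by rw [hxsq']; ring
        _ ≤ q * 1 := by linarith
    exact le_of_mul_le_mul_left h1 hq'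
  set z := 80 * (κ : ℝ) ^ 2 * x with hzdef
  have hz0 : 0 < z := by positivity
  have hz1 : z ≤ 1 := by nlinarith [mul_le_mul_of_nonneg_right hw (sq_nonneg z)]
  have hgap' : (1 + z) * Real.exp (v (idx j)) ≤ Real.exp (v (idx i)) := by
    have hD : 0 ≤ Real.exp (v (idx i)) - Real.exp (v (idx j)) :=
      sub_nonneg.2 (Real.exp_le_exp.2 hij)
    have h1 : (z * Real.exp (v (idx j))) ^ 2 ≤
        (Real.exp (v (idx i)) - Real.exp (v (idx j))) ^ 2 := by
      calc (z * Real.exp (v (idx j))) ^ 2 = z ^ 2 * Real.exp (v (idx j)) ^ 2 := by ring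
        _ ≤ z ^ 2 * (w * (Real.exp (v (idx i)) - Real.exp (v (idx j))) ^ 2) := by gcongr
        _ = (w * z ^ 2) * (Real.exp (v (idx i)) - Real.exp (v (idx j))) ^ 2 := by ring
        _ ≤ 1 * (Real.exp (v (idx i)) - Real.exp (v (idx j))) ^ 2 := by gcongr
        _ = _ := one_mul _
    have := abs_le_of_sq_le_sq h1 hD
    linarith [(abs_le.1 (abs_le_of_sq_le_sq h1 hD)).2, this]
  obtain ⟨p, p0, pd, hp⟩ := hp.exists_seq
  have hchoose : ∀ r, ∃ u, r < d →
      (E u = (idx (p r), idx (p (r + 1))) ∨ E u = (idx (p (r + 1)), idx (p r))) := by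
    intro r
    by_cases hr : r < d
    · obtain ⟨u, hu⟩ := (hp r hr).2
      exact ⟨u, fun _ => hu⟩
    -- Beyond the path an arbitrary edge is needed as a default value. One exists because d = 0
    -- would make the endpoints equal, against the gap.
    · obtain ⟨u, -⟩ : ∃ u : Fin s, True := by
        rcases Nat.eq_zero_or_pos d with rfl | hd0
        · exfalso
          rw [← p0, ← pd] at hgap'
          nlinarith [Real.exp_pos (v (idx (p 0)))]
        · obtain ⟨u, -⟩ := (hp 0 hd0).2
          exact ⟨u, trivial⟩
      exact ⟨u, fun h => absurd h hr⟩
  choose e he using hchoose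
  set t : ℕ → ℝ := fun r => Real.exp (v (idx (p r))) with ht
  have htpos : ∀ r, 0 < t r := fun r => Real.exp_pos _
  refine ⟨d, fun r => idx (p r), e, hd, congrArg idx p0, congrArg idx pd, fun r hr => ?_, ?_⟩
  · have hmono : t (r + 1) ≤ t r := Real.exp_le_exp.2 (hidx (hp r hr).1.le)
    obtain ⟨c1, c2⟩ := hR.close hq1 hql (he r hr)
    have := edgeLabel_up_iff.2 (c1.count_le hx0.le (hxy.trans hy) (by positivity) (by positivity)
      (htpos r) hmono)
    rcases this with h | h | h
    · exact Or.inl ⟨he r hr, h⟩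
    · exact Or.inr (Or.inl ⟨he r hr, h⟩)
    · exact Or.inr (Or.inr ⟨he r hr, h⟩)
  · by_contra hcon
    push Not at hcon
    have hle : ∀ r < d, t r ≤ (1 + 40 * (κ * x)) * t (r + 1) := by
      intro r hr
      by_contra h
      refine hcon r hr ⟨he r hr, edgeLabel_gt_iff.2 ?_⟩
      obtain ⟨c1, c2⟩ := hR.close hq1 hql (he r hr)
      have := c1.count_gt hx0.le hxy hy (by positivity) (by positivity)
        (htpos r) (not_le.1 h).le
      rwa [← mul_assoc (32 : ℝ)] at this
    have h1 : ∀ r ≤ d, t 0 ≤ (1 + 40 * (κ * x)) ^ r * t r := by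
      intro r
      induction r with
      | zero => simp
      | succ r ih =>
        intro hr
        calc t 0 ≤ (1 + 40 * (κ * x)) ^ r * t r := ih (by omega)
          _ ≤ (1 + 40 * (κ * x)) ^ r * ((1 + 40 * (κ * x)) * t (r + 1)) := by
            gcongr
            exact hle r hr
          _ = _ := by ring
    have h4 : (1 + 40 * (κ * x)) ^ d < 1 + z := by
      calc (1 + 40 * (κ * x)) ^ d ≤ (1 + 40 * (κ * x)) ^ κ :=
            pow_le_pow_right₀ (by linarith) hd
        _ ≤ Real.exp (40 * (κ * x)) ^ κ := pow_le_pow_left₀ (by positivity)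
            (by linarith [Real.add_one_le_exp (40 * (κ * x))]) _
        _ = Real.exp (z / 2) := by rw [← Real.exp_nat_mul]; congr 1; rw [hzdef]; ring
        _ < _ := by
          have := Real.abs_exp_sub_one_sub_id_le (x := z / 2)
            (by rw [abs_of_pos (by positivity)]; linarith)
          have := (abs_le.1 this).2
          nlinarith
    have h5 := h1 d le_rfl
    have h6 : t 0 < (1 + z) * t d := h5.trans_lt (mul_lt_mul_of_pos_right h4 (htpos d))
    simp only [ht, p0, pd] at h6
    linarith

end Soundness

/-! ### One call of the algorithm on the good event -/

section Level

variable {n : ℕ}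

theorem exists_antitone_enumeration (W : Finset (Fin n)) (hW : W.Nonempty) (v : Fin n → ℝ) :
    ∃ idx : ℕ → Fin n, Set.InjOn idx (Finset.range W.card) ∧ (∀ i, idx i ∈ W) ∧
      (∀ a ∈ W, ∃ i < W.card, idx i = a) ∧ Antitone fun i => v (idx i) := by
  have hm : 0 < W.card := hW.card_pos
  let g : Fin W.card → Fin n := fun i => (W.equivFin.symm i : Fin n)
  let σ := Tuple.sort fun i => -v (g i)
  have hσ : Monotone ((fun i => -v (g i)) ∘ σ) := Tuple.monotone_sort _
  have hg : Function.Injective g := fun i j h => W.equivFin.symm.injective (Subtype.ext h)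
  -- Positions past the end repeat the last item, so that monotonicity and membership hold on all of
  -- ℕ.
  let c : ℕ → Fin W.card := fun i => ⟨min i (W.card - 1), by omega⟩
  have hc : ∀ i (hi : i < W.card), c i = ⟨i, hi⟩ := fun i hi => Fin.ext (by simp [c]; omega)
  refine ⟨fun i => g (σ (c i)), fun i hi j hj h => ?_, fun i => (W.equivFin.symm _).2,
    fun a ha => ?_, fun i j hij => ?_⟩
  · have hi' : i < W.card := by simpa using hi
    have hj' : j < W.card := by simpa using hj
    have h1 := σ.injective (hg h)
    rw [hc i hi', hc j hj'] at h1
    exact Fin.mk.inj h1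
  · refine ⟨σ.symm (W.equivFin ⟨a, ha⟩), Fin.is_lt _, ?_⟩
    simp [hc, g]
  · have : c i ≤ c j := by
      change min i _ ≤ min j _
      omega
    exact neg_le_neg_iff.1 (hσ this)

/-- The set `T` consists of the items of utility at least `log hi`, all others having utility at
most `log lo`. -/
structure Separates (v : Fin n → ℝ) (T : Finset (Fin n)) (lo hi : ℝ) : Prop where
  lo_pos : 0 < lo
  lt : lo < hi
  le_of_mem : ∀ a ∈ T, hi ≤ Real.exp (v a)
  le_of_notMem : ∀ a ∉ T, Real.exp (v a) ≤ lo

open Classical in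
/-- One plus the inverse squared relative gap of an item. -/
noncomputable def weight (v : Fin n → ℝ) (T : Finset (Fin n)) (lo hi : ℝ) (a : Fin n) : ℝ :=
  1 + if a ∈ T then lo ^ 2 / (lo - Real.exp (v a)) ^ 2 else hi ^ 2 / (hi - Real.exp (v a)) ^ 2

variable {v : Fin n → ℝ} {T W : Finset (Fin n)} {lo hi : ℝ}

theorem one_le_weight (a : Fin n) : 1 ≤ weight v T lo hi a := by
  unfold weight
  split_ifs <;> linarith [div_nonneg (sq_nonneg lo) (sq_nonneg (lo - Real.exp (v a))),
    div_nonneg (sq_nonneg hi) (sq_nonneg (hi - Real.exp (v a)))]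

theorem Separates.mem_of_le (hT : Separates v T lo hi) {a b : Fin n} (ha : a ∈ T)
    (hab : v a ≤ v b) : b ∈ T := by
  by_contra hb
  linarith [hT.le_of_mem a ha, hT.le_of_notMem b hb, Real.exp_le_exp.2 hab, hT.lt]

theorem Separates.idx_mem_iff (hT : Separates v T lo hi) {idx : ℕ → Fin n}
    (hinj : Set.InjOn idx (Finset.range W.card)) (hmem : ∀ i, idx i ∈ W)
    (hsurj : ∀ a ∈ W, ∃ i < W.card, idx i = a) (hanti : Antitone fun i => v (idx i))
    {i : ℕ} (hi : i < W.card) : idx i ∈ T ↔ i < (W ∩ T).card := by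
  classical
  set I := (Finset.range W.card).filter fun i => idx i ∈ T with hI
  have himg : I.image idx = W ∩ T := by
    ext a
    simp only [hI, Finset.mem_image, Finset.mem_filter, Finset.mem_range, Finset.mem_inter]
    constructor
    · rintro ⟨i, ⟨-, h⟩, rfl⟩
      exact ⟨hmem i, h⟩
    · rintro ⟨ha, haT⟩
      obtain ⟨i, hi, rfl⟩ := hsurj a ha
      exact ⟨i, ⟨hi, haT⟩, rfl⟩
  have hcard : I.card = (W ∩ T).card := by
    rw [← himg, Finset.card_image_of_injOn (hinj.mono (by exact_mod_cast Finset.filter_subset _ _))]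
  rw [← hcard]
  constructor
  · intro h
    have : Finset.range (i + 1) ⊆ I := fun j hj => by
      have hj' := Finset.mem_range.1 hj
      exact Finset.mem_filter.2 ⟨Finset.mem_range.2 (by omega),
        hT.mem_of_le h (hanti (by omega : j ≤ i))⟩
    have := Finset.card_le_card this
    rw [Finset.card_range] at this
    omega
  · intro h
    by_contra hn
    have : I ⊆ Finset.range i := fun j hj => by
      rw [Finset.mem_range]
      by_contra hij
      exact hn (hT.mem_of_le (Finset.mem_filter.1 hj).2 (hanti (not_lt.1 hij)))
    have := Finset.card_le_card this
    rw [Finset.card_range] at this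
    omega

variable {s κ l q₀ q : ℕ} {E : Fin s → Fin n × Fin n} {R : ℕ × Fin s → Fin n}

/-- By soundness, an item outside `T` can only dominate other items of `W \ T`, hence at most |W| -
k - 1 of them, one short of the acceptance threshold. -/
theorem Separates.accepted_subset (hT : Separates v T lo hi) (hR : Concentrated κ v E R l)
    (hκ : 1 ≤ κ) (hq₀ : 10000 * κ ^ 3 ≤ q₀) (hq : q < 2 ^ l) :
    accepted κ q₀ W (W ∩ T).card E R q ⊆ W ∩ T := by
  classical
  intro i hi
  obtain ⟨hiW, p, h1, h2, h3⟩ := Finset.mem_filter.1 hi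
  refine Finset.mem_inter.2 ⟨hiW, ?_⟩
  by_contra hiT
  have hsub : (W.filter fun j => StrictlyAbove κ E R p i j) ⊆ (W \ T).erase i := by
    intro j hj
    obtain ⟨hjW, hj⟩ := Finset.mem_filter.1 hj
    have hlt := hj.lt hR hκ (hq₀.trans h1) (h2.trans_lt hq)
    refine Finset.mem_erase.2 ⟨fun h => by simp [h] at hlt, Finset.mem_sdiff.2 ⟨hjW, fun h => ?_⟩⟩
    exact hiT (hT.mem_of_le h hlt.le)
  have h4 := Finset.card_le_card hsub
  have hi' : i ∈ W \ T := Finset.mem_sdiff.2 ⟨hiW, hiT⟩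
  rw [Finset.card_erase_of_mem hi'] at h4
  have h5 := Finset.card_pos.2 ⟨i, hi'⟩
  have h6 := Finset.card_sdiff_add_card_inter W T
  omega

theorem Separates.rejected_subset (hT : Separates v T lo hi) (hR : Concentrated κ v E R l)
    (hκ : 1 ≤ κ) (hq₀ : 10000 * κ ^ 3 ≤ q₀) (hq : q < 2 ^ l) :
    rejected κ q₀ W (W ∩ T).card E R q ⊆ W \ T := by
  classical
  intro i hi
  obtain ⟨hiW, p, h1, h2, h3⟩ := Finset.mem_filter.1 hi
  refine Finset.mem_sdiff.2 ⟨hiW, fun hiT => ?_⟩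
  have hsub : (W.filter fun j => StrictlyAbove κ E R p j i) ⊆ (W ∩ T).erase i := by
    intro j hj
    obtain ⟨hjW, hj⟩ := Finset.mem_filter.1 hj
    have hlt := hj.lt hR hκ (hq₀.trans h1) (h2.trans_lt hq)
    exact Finset.mem_erase.2 ⟨fun h => by simp [h] at hlt,
      Finset.mem_inter.2 ⟨hjW, hT.mem_of_le hiT hlt.le⟩⟩
  have h4 := Finset.card_le_card hsub
  have hi' : i ∈ W ∩ T := Finset.mem_inter.2 ⟨hiW, hiT⟩
  rw [Finset.card_erase_of_mem hi'] at h4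
  have h5 := Finset.card_pos.2 ⟨i, hi'⟩
  omega

/-- The amortisation of the cost: a quarter of the items having weight at least w pays for w rounds
on all of `W`. -/
theorem card_mul_le_sum_weight {idx : ℕ → Fin n} (hinj : Set.InjOn idx (Finset.range W.card))
    (hmem : ∀ i, idx i ∈ W) {i j : ℕ} {w : ℝ} (hw : 0 ≤ w) (hj : j ≤ W.card)
    (hij : W.card ≤ 4 * (j - i))
    (hle : ∀ p, i ≤ p → p < j → w ≤ weight v T lo hi (idx p)) :
    W.card * w ≤ 4 * ∑ a ∈ W, weight v T lo hi a := by
  classical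
  have hsub : (Finset.Ico i j).image idx ⊆ W := Finset.image_subset_iff.2 fun p _ => hmem p
  have hinj' : Set.InjOn idx (Finset.Ico i j) := hinj.mono fun p hp => by
    simp only [Finset.coe_Ico, Set.mem_Ico] at hp
    simp; omega
  have h1 : ((j - i : ℕ) : ℝ) * w ≤ ∑ a ∈ W, weight v T lo hi a := by
    calc ((j - i : ℕ) : ℝ) * w = ∑ p ∈ Finset.Ico i j, w := by simp
      _ ≤ ∑ p ∈ Finset.Ico i j, weight v T lo hi (idx p) := Finset.sum_le_sum fun p hp =>
        hle p (Finset.mem_Ico.1 hp).1 (Finset.mem_Ico.1 hp).2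
      _ = ∑ a ∈ (Finset.Ico i j).image idx, weight v T lo hi a :=
        (Finset.sum_image hinj').symm
      _ ≤ _ := Finset.sum_le_sum_of_subset_of_nonneg hsub fun a _ _ =>
        zero_le_one.trans (one_le_weight a)
  have h2 : (W.card : ℝ) ≤ 4 * ((j - i : ℕ) : ℝ) := by exact_mod_cast hij
  calc (W.card : ℝ) * w ≤ (4 * ((j - i : ℕ) : ℝ)) * w := mul_le_mul_of_nonneg_right h2 hw
    _ = 4 * (((j - i : ℕ) : ℝ) * w) := by ring
    _ ≤ _ := by linarith

theorem sq_le_weight_mul {u g G t w : ℝ} (hg : 0 < g) (hgG : g ≤ G) (ht : 0 ≤ t) (htu : t ≤ u)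
    (hw : 1 + u ^ 2 / g ^ 2 ≤ w) : t ^ 2 ≤ w * G ^ 2 := by
  have hg2 : 0 < g ^ 2 := by positivity
  calc t ^ 2 ≤ u ^ 2 := by gcongr
    _ = u ^ 2 / g ^ 2 * g ^ 2 := by field_simp
    _ ≤ w * G ^ 2 := by
      apply mul_le_mul (by linarith) (by gcongr) hg2.le
      linarith [div_nonneg (sq_nonneg u) (sq_nonneg g)]

/-- The item produced is the member closest to the boundary of an extreme quarter that lies opposite
to the smaller side. Once its weight is resolved the whole quarter is decided, because the rest of
the quarter has larger gaps and every item to be compared with is more than m/8 positions away. -/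
theorem Separates.exists_breaks (hT : Separates v T lo hi) (hW : 2 ≤ W.card)
    (hκ : 1 ≤ κ) {L : ℕ} (hL1 : 1 ≤ L) (hL : W.card ≤ 3 ^ L) (hLκ : 2 * L + 1 ≤ κ)
    (hq₀ : 10000 * κ ^ 3 ≤ q₀) {idx : ℕ → Fin n}
    (hinj : Set.InjOn idx (Finset.range W.card)) (hmem : ∀ i, idx i ∈ W)
    (hsurj : ∀ a ∈ W, ∃ i < W.card, idx i = a) (hanti : Antitone fun i => v (idx i))
    (hE : Expanding W.card (max 1 (W.card / (16 * L))) idx E) (hR : Concentrated κ v E R l) :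
    ∃ a ∈ W, W.card * weight v T lo hi a ≤ 4 * ∑ a ∈ W, weight v T lo hi a ∧
      ∀ q, q₀ ≤ q → q < 2 ^ l → 6400 * (κ : ℝ) ^ 5 * weight v T lo hi a ≤ q →
        Breaks κ q₀ W (W ∩ T).card E R q := by
  classical
  set m := W.card with hm
  set k := (W ∩ T).card with hk
  have hkm : k ≤ m := Finset.card_le_card Finset.inter_subset_left
  have hiff : ∀ {i}, i < m → (idx i ∈ T ↔ i < k) := fun hi =>
    hT.idx_mem_iff hinj hmem hsurj hanti hi
  -- This is m/4 rounded up, so deciding h items is enough to leave the loop.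
  set h := (m + 3) / 4 with hh
  have hexp : ∀ {i j}, i ≤ j → Real.exp (v (idx j)) ≤ Real.exp (v (idx i)) := fun hij =>
    Real.exp_le_exp.2 (hanti hij)
  rcases le_or_gt (2 * k) m with hcase | hcase
  · have haT : idx (m - h) ∉ T := by rw [hiff (by omega)]; omega
    have ha := hT.le_of_notMem _ haT
    refine ⟨idx (m - h), hmem _, ?_, fun q hq1 hq2 hq3 => ⟨hq1, ?_⟩⟩
    -- The items at positions k to m - h lie outside `T` and are at least as close to the boundary
    -- as the chosen one, so their weights are no smaller.
    · refine card_mul_le_sum_weight hinj hmem (zero_le_one.trans (one_le_weight _))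
        (i := k) (j := m - h + 1) (by omega) (by omega) fun p hp1 hp2 => ?_
      have hpT : idx p ∉ T := by rw [hiff (by omega)]; omega
      have := hT.le_of_notMem _ hpT
      have := hexp (show p ≤ m - h by omega)
      have := hT.lt
      rw [weight, weight, if_neg haT, if_neg hpT]
      have h0 : 0 < hi - Real.exp (v (idx p)) := by linarith
      gcongr
    · have hsub : (Finset.Ico (m - h) m).image idx ⊆ rejected κ q₀ W k E R q := by
        intro b hb
        obtain ⟨p, hp, rfl⟩ := Finset.mem_image.1 hb
        rw [Finset.mem_Ico] at hp
        refine Finset.mem_filter.2 ⟨hmem p, q, hq1, le_rfl, ?_⟩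
        have hsub' : (Finset.range k).image idx ⊆
            W.filter fun j => StrictlyAbove κ E R q j (idx p) := by
          intro c hc
          obtain ⟨i, hik, rfl⟩ := Finset.mem_image.1 hc
          rw [Finset.mem_range] at hik
          refine Finset.mem_filter.2 ⟨hmem i, ?_⟩
          obtain ⟨d, hd, hpath⟩ := hE.short_path hL1 hL (i := i) (j := p) hp.2 (by omega) (by omega)
          have hiT := hT.le_of_mem _ ((hiff (by omega)).2 hik)
          have hlt := hT.lt
          have hpa := hexp hp.1
          refine hpath.strictlyAbove hR hκ hanti (hq₀.trans hq1) hq2 (hd.trans hLκ)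
            (one_le_weight _) hq3 ?_ (hanti (by omega))
          refine sq_le_weight_mul (u := hi) (g := hi - Real.exp (v (idx (m - h)))) (by linarith)
            (by linarith) (Real.exp_pos _).le (by linarith) ?_
          rw [weight, if_neg haT]
        have := Finset.card_le_card hsub'
        rwa [Finset.card_image_of_injOn (hinj.mono fun p hp => by
          simp only [Finset.coe_range, Set.mem_Iio] at hp ⊢; omega), Finset.card_range] at this
      have h1 := Finset.card_le_card (hsub.trans
        (Finset.subset_union_right (s₁ := accepted κ q₀ W k E R q)))
      rw [Finset.card_image_of_injOn (hinj.mono fun p hp => by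
          simp only [Finset.coe_Ico, Set.mem_Ico, Finset.coe_range, Set.mem_Iio] at hp ⊢; omega),
        Nat.card_Ico] at h1
      omega
  -- The mirror case: the last item of the top quarter is the reference, and the top quarter is
  -- accepted by dominating all of `W \ T`.
  · have haT : idx (h - 1) ∈ T := by rw [hiff (by omega)]; omega
    have ha := hT.le_of_mem _ haT
    have hlt := hT.lt
    have hlo := hT.lo_pos
    refine ⟨idx (h - 1), hmem _, ?_, fun q hq1 hq2 hq3 => ⟨hq1, ?_⟩⟩
    · refine card_mul_le_sum_weight hinj hmem (zero_le_one.trans (one_le_weight _))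
        (i := h - 1) (j := k) (by omega) (by omega) fun p hp1 hp2 => ?_
      have hpT : idx p ∈ T := by rw [hiff (by omega)]; omega
      have := hT.le_of_mem _ hpT
      have := hexp (show h - 1 ≤ p by omega)
      rw [weight, weight, if_pos haT, if_pos hpT, sub_sq_comm lo, sub_sq_comm lo]
      have h0 : 0 < Real.exp (v (idx p)) - lo := by linarith
      gcongr
    · have hsub : (Finset.range h).image idx ⊆ accepted κ q₀ W k E R q := by
        intro b hb
        obtain ⟨p, hp, rfl⟩ := Finset.mem_image.1 hb
        rw [Finset.mem_range] at hp
        refine Finset.mem_filter.2 ⟨hmem p, q, hq1, le_rfl, ?_⟩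
        have hsub' : (Finset.Ico k m).image idx ⊆
            W.filter fun j => StrictlyAbove κ E R q (idx p) j := by
          intro c hc
          obtain ⟨i, hik, rfl⟩ := Finset.mem_image.1 hc
          rw [Finset.mem_Ico] at hik
          refine Finset.mem_filter.2 ⟨hmem i, ?_⟩
          obtain ⟨d, hd, hpath⟩ := hE.short_path hL1 hL (i := p) (j := i) hik.2 (by omega) (by omega)
          have hiT := hT.le_of_notMem (idx i) (by rw [hiff hik.2]; omega)
          have hpa := hexp (show p ≤ h - 1 by omega)
          refine hpath.strictlyAbove hR hκ hanti (hq₀.trans hq1) hq2 (hd.trans hLκ)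
            (one_le_weight _) hq3 ?_ (hanti (by omega))
          refine sq_le_weight_mul (u := lo) (g := Real.exp (v (idx (h - 1))) - lo) (by linarith)
            (by linarith) (Real.exp_pos _).le (by linarith) ?_
          rw [weight, if_pos haT, sub_sq_comm lo]
        have := Finset.card_le_card hsub'
        rwa [Finset.card_image_of_injOn (hinj.mono fun p hp => by
          simp only [Finset.coe_Ico, Set.mem_Ico, Finset.coe_range, Set.mem_Iio] at hp ⊢; omega),
          Nat.card_Ico] at this
      have h1 := Finset.card_le_card (hsub.trans
        (Finset.subset_union_left (s₂ := rejected κ q₀ W k E R q)))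
      rw [Finset.card_image_of_injOn (hinj.mono fun p hp => by
          simp only [Finset.coe_range, Set.mem_Iio] at hp ⊢; omega),
        Finset.card_range] at h1
      omega

/-- On the good event, the loop ends soon and its decisions are right. -/
theorem Separates.exists_loopResult (hT : Separates v T lo hi) (hW : 2 ≤ W.card)
    (hκ : 1 ≤ κ) {L : ℕ} (hL1 : 1 ≤ L) (hL : W.card ≤ 3 ^ L) (hLκ : 2 * L + 1 ≤ κ)
    (hq₀ : 10000 * κ ^ 3 ≤ q₀) {idx : ℕ → Fin n}
    (hinj : Set.InjOn idx (Finset.range W.card)) (hmem : ∀ i, idx i ∈ W)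
    (hsurj : ∀ a ∈ W, ∃ i < W.card, idx i = a) (hanti : Antitone fun i => v (idx i))
    (hE : Expanding W.card (max 1 (W.card / (16 * L))) idx E) (hR : Concentrated κ v E R l)
    (hl : ∀ a, (q₀ : ℝ) + 6400 * (κ : ℝ) ^ 5 * weight v T lo hi a + 1 ≤ 2 ^ l) :
    ∃ G B q, loopResult κ q₀ W (W ∩ T).card E R = some (G, B, q) ∧ G ⊆ W ∩ T ∧ B ⊆ W \ T ∧
      W.card ≤ 4 * (G ∪ B).card ∧
      (W.card : ℝ) * q ≤ W.card * (q₀ + 1) +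
        25600 * (κ : ℝ) ^ 5 * ∑ a ∈ W, weight v T lo hi a := by
  obtain ⟨a, ha, hsum, hbr⟩ := hT.exists_breaks hW hκ hL1 hL hLκ hq₀ hinj hmem hsurj hanti hE hR
  set w := weight v T lo hi a with hw
  have hw1 : 1 ≤ w := one_le_weight a
  set Q := q₀ + ⌈6400 * (κ : ℝ) ^ 5 * w⌉₊ with hQ
  have hQ1 : (Q : ℝ) < q₀ + 6400 * (κ : ℝ) ^ 5 * w + 1 := by
    rw [hQ]; push_cast
    linarith [Nat.ceil_lt_add_one (show 0 ≤ 6400 * (κ : ℝ) ^ 5 * w by positivity)]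
  have hQl : Q < 2 ^ l := by
    have : (Q : ℝ) < 2 ^ l := hQ1.trans_le (hl a)
    exact_mod_cast this
  have hB := hbr Q (by omega) hQl (by
    rw [hQ]; push_cast
    have := Nat.le_ceil (6400 * (κ : ℝ) ^ 5 * w)
    have : (0 : ℝ) ≤ q₀ := by positivity
    linarith)
  have hex : ∃ q, Breaks κ q₀ W (W ∩ T).card E R q := ⟨Q, hB⟩
  classical
  have hfind : Nat.find hex ≤ Q := Nat.find_min' hex hB
  have hres : loopResult κ q₀ W (W ∩ T).card E R =
      some (accepted κ q₀ W (W ∩ T).card E R (Nat.find hex),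
        rejected κ q₀ W (W ∩ T).card E R (Nat.find hex), Nat.find hex) := by
    rw [loopResult, dif_pos hex]
  refine ⟨_, _, _, hres, hT.accepted_subset hR hκ hq₀ (hfind.trans_lt hQl),
    hT.rejected_subset hR hκ hq₀ (hfind.trans_lt hQl), ?_, ?_⟩
  · convert (Nat.find_spec hex).2
  · have h1 : ((Nat.find hex : ℕ) : ℝ) ≤ Q := by exact_mod_cast hfind
    calc (W.card : ℝ) * (Nat.find hex : ℕ) ≤ W.card * (q₀ + 6400 * (κ : ℝ) ^ 5 * w + 1) := by
          gcongr
          linarith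
      _ = W.card * (q₀ + 1) + 6400 * (κ : ℝ) ^ 5 * (W.card * w) := by ring
      _ ≤ W.card * (q₀ + 1) + 6400 * (κ : ℝ) ^ 5 * (4 * ∑ a ∈ W, weight v T lo hi a) := by
          gcongr
      _ = _ := by ring

end Level

/-! ### Measurability of the loop result -/

section Measurability

variable {n s : ℕ}

/-- `R` and `R'` agree in the first `q` rounds. -/
def AgreeBefore (q : ℕ) (R R' : ℕ × Fin s → Fin n) : Prop := ∀ p < q, ∀ u, R (p, u) = R' (p, u)

theorem AgreeBefore.mono {q p : ℕ} {R R' : ℕ × Fin s → Fin n} (h : AgreeBefore q R R')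
    (hp : p ≤ q) : AgreeBefore p R R' := fun r hr => h r (hr.trans_le hp)

theorem AgreeBefore.strictlyAbove {q : ℕ} {R R' : ℕ × Fin s → Fin n} (h : AgreeBefore q R R')
    (κ : ℕ) (E : Fin s → Fin n × Fin n) :
    StrictlyAbove κ E R q = StrictlyAbove κ E R' q := by
  have h1 : wins R q = wins R' q := by
    ext u i
    unfold wins
    congr 1
    exact Finset.filter_congr fun p hp => by rw [h p (Finset.mem_range.1 hp) u]
  have h2 : HasLabel κ E R q = HasLabel κ E R' q := by
    ext u i j l
    simp only [HasLabel, h1]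
  ext i j
  simp only [StrictlyAbove, h2]

theorem AgreeBefore.accepted {q : ℕ} {R R' : ℕ × Fin s → Fin n} (h : AgreeBefore q R R')
    (κ q₀ : ℕ) (W : Finset (Fin n)) (k : ℕ) (E : Fin s → Fin n × Fin n) :
    accepted κ q₀ W k E R q = accepted κ q₀ W k E R' q := by
  classical
  unfold TopK.accepted
  refine Finset.filter_congr fun i _ => exists_congr fun p =>
    and_congr_right fun _ => and_congr_right fun hp => ?_
  rw [(h.mono hp).strictlyAbove]

theorem AgreeBefore.rejected {q : ℕ} {R R' : ℕ × Fin s → Fin n} (h : AgreeBefore q R R')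
    (κ q₀ : ℕ) (W : Finset (Fin n)) (k : ℕ) (E : Fin s → Fin n × Fin n) :
    rejected κ q₀ W k E R q = rejected κ q₀ W k E R' q := by
  classical
  unfold TopK.rejected
  refine Finset.filter_congr fun i _ => exists_congr fun p =>
    and_congr_right fun _ => and_congr_right fun hp => ?_
  rw [(h.mono hp).strictlyAbove]

theorem AgreeBefore.breaks {q : ℕ} {R R' : ℕ × Fin s → Fin n} (h : AgreeBefore q R R')
    (κ q₀ : ℕ) (W : Finset (Fin n)) (k : ℕ) (E : Fin s → Fin n × Fin n) :
    Breaks κ q₀ W k E R q ↔ Breaks κ q₀ W k E R' q := by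
  unfold Breaks
  rw [h.accepted, h.rejected]

/-- An event decided by the first q rounds is a preimage of a subset of a finite discrete space. -/
theorem measurableSet_of_agreeBefore {P : (ℕ × Fin s → Fin n) → Prop} (q : ℕ)
    (h : ∀ R R', AgreeBefore q R R' → P R → P R') : MeasurableSet {R | P R} := by
  let f : (ℕ × Fin s → Fin n) → (Fin q × Fin s → Fin n) := fun R i => R (i.1, i.2)
  have hf : Measurable f := measurable_pi_lambda _ fun i => measurable_pi_apply _
  have : {R | P R} = f ⁻¹' (f '' {R | P R}) := by
    ext R
    refine ⟨fun hR => ⟨R, hR, rfl⟩, ?_⟩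
    rintro ⟨R', hR', hff⟩
    exact h R' R (fun p hp u => congrFun hff (⟨p, hp⟩, u)) hR'
  rw [this]
  exact hf (Set.toFinite _).measurableSet

theorem loopResult_eq_some_iff {κ q₀ : ℕ} {W : Finset (Fin n)} {k : ℕ}
    {E : Fin s → Fin n × Fin n} {R : ℕ × Fin s → Fin n} {G B : Finset (Fin n)} {q : ℕ} :
    loopResult κ q₀ W k E R = some (G, B, q) ↔
      (Breaks κ q₀ W k E R q ∧ ∀ p < q, ¬ Breaks κ q₀ W k E R p) ∧
        accepted κ q₀ W k E R q = G ∧ rejected κ q₀ W k E R q = B := by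
  classical
  unfold loopResult
  by_cases hex : ∃ q, Breaks κ q₀ W k E R q
  · rw [dif_pos hex, Option.some_inj, Prod.mk.injEq, Prod.mk.injEq]
    constructor
    · rintro ⟨h1, h2, h3⟩
      refine ⟨(Nat.find_eq_iff hex).1 ?_, ?_, ?_⟩
      · convert h3
      · rw [← h3]; exact h1
      · rw [← h3]; exact h2
    · rintro ⟨h1, h2, h3⟩
      have h4 : Nat.find hex = q := (Nat.find_eq_iff hex).2 h1
      refine ⟨?_, ?_, ?_⟩
      · rw [← h2, ← h4]
      · rw [← h3, ← h4]
      · convert h4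
  · rw [dif_neg hex]
    simp only [reduceCtorEq, false_iff]
    exact fun h => hex ⟨q, h.1.1⟩

theorem measurableSet_loopResult_eq (κ q₀ : ℕ) (W : Finset (Fin n)) (k : ℕ)
    (E : Fin s → Fin n × Fin n) (o : Option (Finset (Fin n) × Finset (Fin n) × ℕ)) :
    MeasurableSet {R | loopResult κ q₀ W k E R = o} := by
  have hsome : ∀ x, MeasurableSet {R | loopResult κ q₀ W k E R = some x} := by
    rintro ⟨G, B, q⟩
    refine measurableSet_of_agreeBefore q fun R R' h hR => ?_
    rw [loopResult_eq_some_iff] at hR ⊢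
    rw [← h.breaks, ← h.accepted, ← h.rejected]
    exact ⟨⟨hR.1.1, fun p hp => by rw [← (h.mono hp.le).breaks]; exact hR.1.2 p hp⟩, hR.2⟩
  cases o with
  | some x => exact hsome x
  | none =>
    have : {R | loopResult κ q₀ W k E R = none} =
        (⋃ x, {R | loopResult κ q₀ W k E R = some x})ᶜ := by
      ext R
      simp [Option.eq_none_iff_forall_ne_some]
    rw [this]
    exact (MeasurableSet.iUnion hsome).compl

theorem measurable_comp_loopResult {β : Type*} [MeasurableSpace β] (κ q₀ : ℕ)
    (W : Finset (Fin n)) (k : ℕ) (E : Fin s → Fin n × Fin n)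
    (F : Option (Finset (Fin n) × Finset (Fin n) × ℕ) → β) :
    Measurable fun R => F (loopResult κ q₀ W k E R) := by
  intro S _
  have : (fun R => F (loopResult κ q₀ W k E R)) ⁻¹' S =
      ⋃ o ∈ {o | F o ∈ S}, {R | loopResult κ q₀ W k E R = o} := by
    ext R
    simp
  rw [this]
  exact MeasurableSet.biUnion (Set.to_countable _) fun o _ =>
    measurableSet_loopResult_eq κ q₀ W k E o

end Measurability

/-! ### Induction over the recursive calls -/

section Recursion

variable {n : ℕ}

/-- The law of the outcome after the loop has ended with the given result. -/
noncomputable def continueLaw (κ q₀ : ℕ) (v : Fin n → ℝ) (W : Finset (Fin n)) (k : ℕ) :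
    Option (Finset (Fin n) × Finset (Fin n) × ℕ) → Measure (Outcome n)
  | none => Measure.dirac .diverged
  | some (G, B, q) =>
    if ((W \ G) \ B).card < W.card then
      (algPairwise κ q₀ v ((W \ G) \ B) (k - G.card)).map (Outcome.extend G (W.card * κ * q))
    else Measure.dirac .diverged

theorem algPairwise_eq_bind (κ q₀ : ℕ) (v : Fin n → ℝ) {W : Finset (Fin n)} (hW : 2 ≤ W.card)
    (k : ℕ) :
    algPairwise κ q₀ v W k = (pairLaw W (W.card * κ)).bind fun E => (answerLaw v E).bind fun R =>
      continueLaw κ q₀ v W k (loopResult κ q₀ W k E R) := by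
  rw [algPairwise, if_neg (by omega)]
  rfl

/-- Total mass one is what turns a bound on failure into a bound on success; it rests on the
measurability of the kernels, which `bind_apply_le_add` does not ask for. -/
theorem isProbabilityMeasure_algPairwise (κ q₀ : ℕ) (v : Fin n → ℝ) (W : Finset (Fin n)) (k : ℕ) :
    IsProbabilityMeasure (algPairwise κ q₀ v W k) := by
  induction hc : W.card using Nat.strong_induction_on generalizing W k with
  | _ c ih =>
    subst hc
    rcases Nat.lt_or_ge W.card 2 with h | h
    · rw [algPairwise, if_pos (by omega)]
      infer_instance
    · rw [algPairwise_eq_bind κ q₀ v h k]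
      have := isProbabilityMeasure_uniformOn_offDiag h
      have hnext : ∀ o, IsProbabilityMeasure (continueLaw κ q₀ v W k o) := by
        rintro (_ | ⟨G, B, q⟩)
        · exact inferInstanceAs (IsProbabilityMeasure (Measure.dirac _))
        · rw [continueLaw]
          split_ifs with hlt
          · have := ih _ hlt ((W \ G) \ B) (k - G.card) rfl
            exact Measure.isProbabilityMeasure_map measurable_from_top.aemeasurable
          · infer_instance
      refine isProbabilityMeasure_bind (measurable_of_countable _).aemeasurable
        (ae_of_all _ fun E => ?_)
      exact isProbabilityMeasure_bind (measurable_comp_loopResult _ _ _ _ _ _).aemeasurable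
        (ae_of_all _ fun R => hnext _)

/-- The union bound for one random stage: charge 1 on the bad set, enlarged to a measurable set of
the same measure, and e' elsewhere. -/
theorem bind_apply_le_add {α β : Type*} [MeasurableSpace α] [MeasurableSpace β] {m : Measure α}
    [IsProbabilityMeasure m] {f : α → Measure β} {S : Set β} (hS : MeasurableSet S)
    {bad : α → Prop} {e e' : ENNReal} (hbad : m {a | bad a} ≤ e)
    (h1 : ∀ a, f a S ≤ 1) (hgood : ∀ᵐ a ∂m, ¬ bad a → f a S ≤ e') : m.bind f S ≤ e + e' := by
  refine (Measure.bind_apply_le f hS).trans ?_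
  have h2 : ∀ᵐ a ∂m, f a S ≤ (toMeasurable m {a | bad a}).indicator (fun _ => 1) a + e' := by
    filter_upwards [hgood] with a ha
    by_cases hb : bad a
    · rw [Set.indicator_of_mem (subset_toMeasurable m {a | bad a} hb)]
      exact (h1 a).trans le_self_add
    · exact (ha hb).trans le_add_self
  refine (lintegral_mono_ae h2).trans ?_
  rw [lintegral_add_right _ measurable_const, lintegral_indicator (measurableSet_toMeasurable _ _)]
  simp only [lintegral_const, Measure.restrict_apply_univ, measure_toMeasurable, measure_univ,
    mul_one, one_mul]
  gcongr

theorem measurableSet_outcome (S : Set (Outcome n)) : MeasurableSet S :=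
  MeasurableSpace.measurableSet_top

/-- The outcomes in which the run returns `S` after at most `t` comparisons. -/
def haltedWithin (S : Finset (Fin n)) (t : ℝ) : Set (Outcome n) :=
  {o | ∃ t' : ℕ, o = .halted S t' ∧ (t' : ℝ) ≤ t}

theorem Outcome.extend_mem_haltedWithin {G S : Finset (Fin n)} {t t₀ t₁ : ℝ} {t' : ℕ}
    {o : Outcome n} (ho : o ∈ haltedWithin S t₁) (ht : (t' : ℝ) ≤ t₀) (h : t₀ + t₁ ≤ t) :
    o.extend G t' ∈ haltedWithin (G ∪ S) t := by
  obtain ⟨t'', rfl, h'⟩ := ho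
  refine ⟨t' + t'', rfl, ?_⟩
  push_cast
  linarith

/-- Losing a quarter of the labels lowers the logarithm by at least 1 - 3/4, so one unit of cost is
paid. For a = 0 the convention log 0 = 0 applies, and b ≥ 2 suffices since 4 log 2 > 1. -/
theorem one_add_log_le {a b : ℕ} (hb : 2 ≤ b) (hab : 4 * a ≤ 3 * b) :
    1 + (1 + 4 * Real.log a) ≤ 1 + 4 * Real.log b := by
  have hb' : (2 : ℝ) ≤ b := by exact_mod_cast hb
  have hab' : (4 : ℝ) * a ≤ 3 * b := by exact_mod_cast hab
  rcases Nat.eq_zero_or_pos a with rfl | ha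
  · have := Real.log_le_log (by norm_num) hb'
    have := Real.log_two_gt_d9
    simp only [Nat.cast_zero, Real.log_zero]
    linarith
  · have ha' : (0 : ℝ) < a := by exact_mod_cast ha
    have h1 := Real.one_sub_inv_le_log_of_pos (show (0 : ℝ) < b / a by positivity)
    rw [Real.log_div (by positivity) (by positivity), inv_div] at h1
    have h2 : (a : ℝ) / b ≤ 3 / 4 := by
      rw [div_le_div_iff₀ (by positivity) (by norm_num)]
      linarith
    linarith

variable {v : Fin n → ℝ} {T : Finset (Fin n)} {lo hi : ℝ} {κ L q₀ l : ℕ}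

/-- Strong induction on |W|. Correct decisions preserve the invariant that the parameter k is |W ∩
T|; a call costs at most M, with M computed from all n labels; and there are at most |W| calls, each
failing with probability at most e₁ + e₂. -/
theorem Separates.algPairwise_fail_le (hT : Separates v T lo hi) (hκ : 1 ≤ κ) (hL1 : 1 ≤ L)
    (hL : n ≤ 3 ^ L) (hLκ : 2 * L + 1 ≤ κ) (hq₀ : 10000 * κ ^ 3 ≤ q₀)
    (hl : ∀ a, (q₀ : ℝ) + 6400 * (κ : ℝ) ^ 5 * weight v T lo hi a + 1 ≤ 2 ^ l)
    {e₁ e₂ : ENNReal}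
    (he₁ : ∀ (W : Finset (Fin n)) (idx : ℕ → Fin n), 2 ≤ W.card →
      Set.InjOn idx (Finset.range W.card) → (∀ i, idx i ∈ W) →
      pairLaw W (W.card * κ) {E | ¬ Expanding W.card (max 1 (W.card / (16 * L))) idx E} ≤ e₁)
    (he₂ : ∀ s ≤ n * κ, ENNReal.ofReal (s * (2 * l * Real.exp (-((κ : ℝ) / 4)))) ≤ e₂)
    {M : ℝ} (hM : (n * (q₀ + 1) + 25600 * (κ : ℝ) ^ 5 * ∑ a, weight v T lo hi a) * κ ≤ M)
    (W : Finset (Fin n)) :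
    algPairwise κ q₀ v W (W ∩ T).card
      (haltedWithin (W ∩ T) (M * (1 + 4 * Real.log W.card)))ᶜ ≤ W.card * (e₁ + e₂) := by
  classical
  have hM0 : 0 ≤ M := by
    refine le_trans ?_ hM
    have : 0 ≤ ∑ a, weight v T lo hi a :=
      Finset.sum_nonneg fun a _ => zero_le_one.trans (one_le_weight a)
    positivity
  have hlog : ∀ m : ℕ, 0 ≤ M * (1 + 4 * Real.log m) := fun m =>
    mul_nonneg hM0 (by linarith [Real.log_natCast_nonneg m])
  induction hc : W.card using Nat.strong_induction_on generalizing W with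
  | _ c ih =>
    subst hc
    rcases Nat.lt_or_ge W.card 2 with hW | hW
    · rw [algPairwise, if_pos (by omega)]
      have hret : (if (W ∩ T).card = 0 then ∅ else W) = W ∩ T := by
        split_ifs with h0
        · exact (Finset.card_eq_zero.1 h0).symm
        · exact (Finset.eq_of_subset_of_card_le Finset.inter_subset_left (by omega)).symm
      rw [hret, Measure.dirac_apply' _ (measurableSet_outcome _), Set.indicator_of_notMem]
      · exact zero_le
      · rw [Set.notMem_compl_iff]
        exact ⟨0, rfl, by simpa using hlog _⟩
    · have hWne : W.Nonempty := Finset.card_pos.1 (by omega)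
      obtain ⟨idx, hinj, hmem, hsurj, hanti⟩ := exists_antitone_enumeration W hWne v
      have := isProbabilityMeasure_uniformOn_offDiag hW
      have hWn : W.card ≤ n := by simpa using Finset.card_le_univ W
      have hle1 : ∀ k, algPairwise κ q₀ v W k
          (haltedWithin (W ∩ T) (M * (1 + 4 * Real.log W.card)))ᶜ ≤ 1 := fun k => by
        have := isProbabilityMeasure_algPairwise κ q₀ v W k
        exact prob_le_one
      have hcont : ∀ o, IsProbabilityMeasure (continueLaw κ q₀ v W (W ∩ T).card o) := by
        rintro (_ | ⟨G, B, q⟩)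
        · exact inferInstanceAs (IsProbabilityMeasure (Measure.dirac _))
        · rw [continueLaw]
          split_ifs with hlt
          · have := isProbabilityMeasure_algPairwise κ q₀ v ((W \ G) \ B) ((W ∩ T).card - G.card)
            exact Measure.isProbabilityMeasure_map measurable_from_top.aemeasurable
          · infer_instance
      have hprob : ∀ E, IsProbabilityMeasure ((answerLaw v E).bind fun R =>
          continueLaw κ q₀ v W (W ∩ T).card
            (loopResult (s := W.card * κ) κ q₀ W (W ∩ T).card E R)) := fun E =>
        isProbabilityMeasure_bind (measurable_comp_loopResult _ _ _ _ _ _).aemeasurable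
          (ae_of_all _ fun R => hcont _)
      rw [algPairwise_eq_bind κ q₀ v hW]
      -- The next set is strictly smaller than `W`, so the failure probability of this call fits
      -- into one of the |W| summands.
      have hfin : e₁ + (e₂ + ((W.card - 1 : ℕ) : ENNReal) * (e₁ + e₂)) = W.card * (e₁ + e₂) := by
        have : (W.card : ENNReal) = 1 + ((W.card - 1 : ℕ) : ENNReal) := by
          rw [← Nat.cast_one, ← Nat.cast_add]
          congr 1
          omega
        rw [this, add_mul, one_mul, add_assoc]
      rw [← hfin]
      refine bind_apply_le_add (measurableSet_outcome _) (he₁ W idx hW hinj hmem) (fun E => prob_le_one) ?_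
      filter_upwards [pairLaw_ae_mem hW] with E hEmem hE
      have hEne : ∀ u, (E u).1 ≠ (E u).2 := fun u => (Finset.mem_offDiag.1 (hEmem u)).2.2
      refine bind_apply_le_add (measurableSet_outcome _) ((answerLaw_not_concentrated κ hκ v E hEne l).trans
        (he₂ _ (by gcongr))) (fun R => prob_le_one) (ae_of_all _ fun R hR => ?_)
      obtain ⟨G, B, q, hres, hG, hB, hcard, hcost⟩ := hT.exists_loopResult hW hκ hL1
        (hWn.trans hL) hLκ hq₀ hinj hmem hsurj hanti (not_not.1 hE) (not_not.1 hR) hl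
      set W' := (W \ G) \ B with hW'
      have hGW : G ⊆ W := hG.trans Finset.inter_subset_left
      have hBW : B ⊆ W := hB.trans Finset.sdiff_subset
      have hW'c : W'.card + (G ∪ B).card = W.card := by
        rw [hW', sdiff_sdiff_left]
        exact Finset.card_sdiff_add_card_eq_card (Finset.union_subset hGW hBW)
      have hW'T : W' ∩ T = (W ∩ T) \ G := by
        ext a
        simp only [hW', Finset.mem_inter, Finset.mem_sdiff]
        constructor
        · rintro ⟨⟨⟨h1, h2⟩, h3⟩, h4⟩
          exact ⟨⟨h1, h4⟩, h2⟩
        · rintro ⟨⟨h1, h4⟩, h2⟩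
          exact ⟨⟨⟨h1, h2⟩, fun h3 => (Finset.mem_sdiff.1 (hB h3)).2 h4⟩, h4⟩
      have hk' : (W ∩ T).card - G.card = (W' ∩ T).card := by
        rw [hW'T, Finset.card_sdiff_of_subset hG]
      have hlt : W'.card < W.card := by omega
      rw [hres, continueLaw, if_pos hlt, Measure.map_apply measurable_from_top (measurableSet_outcome _), hk']
      refine (measure_mono ?_).trans ((ih _ hlt W' rfl).trans ?_)
      · intro o ho
        rw [Set.mem_compl_iff]
        intro hcon
        refine ho ?_
        have hun : G ∪ (W' ∩ T) = W ∩ T := by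
          rw [hW'T]
          exact Finset.union_sdiff_of_subset hG
        rw [← hun]
        refine Outcome.extend_mem_haltedWithin hcon (t₀ := M) ?_ ?_
        · refine le_trans ?_ hM
          push_cast
          calc (W.card : ℝ) * κ * q = (W.card * q) * κ := by ring
            _ ≤ _ := by
              apply mul_le_mul_of_nonneg_right _ (by positivity)
              refine hcost.trans ?_
              have h1 : ∑ a ∈ W, weight v T lo hi a ≤ ∑ a, weight v T lo hi a :=
                Finset.sum_le_sum_of_subset_of_nonneg (Finset.subset_univ _) fun a _ _ =>
                  zero_le_one.trans (one_le_weight a)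
              gcongr
        · have := mul_le_mul_of_nonneg_left
            (one_add_log_le (a := W'.card) hW (by omega)) hM0
          linarith
      · gcongr
        omega

end Recursion

/-! ### Choice of the parameters -/

section Parameters

/-- The window satisfies m/b ≤ 32L ≤ 80 log n, so the exponent is at least κ/(1280 log n); making
this D log n requires κ of order log² n. -/
theorem exp_neg_div_window_le {κ m n L : ℕ} {D l : ℝ} (hl : 0 < l) (hln : Real.log n = l)
    (hm : 1 ≤ m) (hL1 : 1 ≤ L) (hL : (L : ℝ) ≤ 5 / 2 * l)
    (hκ : 1280 * D * l ^ 2 ≤ κ) :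
    Real.exp (-(κ * (max 1 (m / (16 * L)) : ℕ) / (16 * m))) ≤ Real.exp (-(D * Real.log n)) := by
  rw [hln]
  apply Real.exp_le_exp.2
  rw [neg_le_neg_iff]
  have hb : m ≤ (max 1 (m / (16 * L))) * (32 * L) := by
    rcases Nat.lt_or_ge m (16 * L) with h | h
    · calc m ≤ 1 * (32 * L) := by omega
        _ ≤ _ := Nat.mul_le_mul_right _ (le_max_left _ _)
    · have h1 : 1 ≤ m / (16 * L) := (Nat.one_le_div_iff (by omega)).2 h
      have h2 := Nat.div_add_mod m (16 * L)
      have h3 := Nat.mod_lt m (show 16 * L > 0 by omega)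
      have h4 : 16 * L * 1 ≤ 16 * L * (m / (16 * L)) := Nat.mul_le_mul_left _ h1
      calc m ≤ (m / (16 * L)) * (32 * L) := by
            have : (m / (16 * L)) * (32 * L) = 2 * (16 * L * (m / (16 * L))) := by ring
            omega
        _ ≤ _ := Nat.mul_le_mul_right _ (le_max_right _ _)
  generalize max 1 (m / (16 * L)) = b at hb ⊢
  have hb' : (m : ℝ) ≤ b * (32 * L) := by exact_mod_cast hb
  have hm' : (0 : ℝ) < m := by exact_mod_cast hm
  have h5 : (m : ℝ) ≤ b * (80 * l) := hb'.trans (by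
    apply mul_le_mul_of_nonneg_left _ (by positivity)
    linarith)
  rw [le_div_iff₀ (by positivity)]
  have hκ0 : (0 : ℝ) ≤ κ := by positivity
  have h6 : (80 * l) * (D * l * (16 * m)) ≤ (80 * l) * (κ * b) := by
    calc (80 * l) * (D * l * (16 * m)) = (1280 * D * l ^ 2) * m := by ring
      _ ≤ κ * m := by gcongr
      _ ≤ κ * (b * (80 * l)) := by gcongr
      _ = _ := by ring
  exact le_of_mul_le_mul_left h6 (by positivity)

/-- The number l of dyadic blocks is of order log X, linear in κ and log ρ. The hypothesis gives 1 +
log ρ ≤ e^(κ/16), so l is at most a constant times e^(κ/16), which the concentration bound e^(-κ/4)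
absorbs. -/
theorem exists_dyadic_bound {κ : ℕ} (A : ℕ) {ρ : ℝ} (hκ : 1 ≤ κ) (hρ : 1 ≤ ρ)
    (h : 16 * Real.log (1 + Real.log ρ) ≤ κ) :
    ∃ l : ℕ, (A : ℝ) * κ ^ 3 + 12800 * (κ : ℝ) ^ 5 * ρ ^ 2 + 1 ≤ 2 ^ l ∧
      (l : ℝ) ≤ (2 * (A + 12801) + 165) * Real.exp (κ / 16) := by
  have hκ' : (1 : ℝ) ≤ κ := by exact_mod_cast hκ
  set X : ℝ := (A + 12801) * κ ^ 5 * ρ ^ 2 with hX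
  have hX1 : 1 ≤ X := by
    have h1 : (1 : ℝ) ≤ κ ^ 5 := one_le_pow₀ hκ'
    have h2 : (1 : ℝ) ≤ ρ ^ 2 := one_le_pow₀ hρ
    have h3 : (1 : ℝ) ≤ A + 12801 := by linarith [show (0 : ℝ) ≤ A by positivity]
    exact one_le_mul_of_one_le_of_one_le (one_le_mul_of_one_le_of_one_le h3 h1) h2
  have hlogX : Real.log X ≤ (A + 12801) + 5 * κ + 2 * Real.log ρ := by
    rw [hX, Real.log_mul (by positivity) (by positivity), Real.log_mul (by positivity)
      (by positivity), Real.log_pow, Real.log_pow]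
    have h1 := Real.log_le_sub_one_of_pos (show (0 : ℝ) < A + 12801 by positivity)
    have h2 := Real.log_le_sub_one_of_pos (show (0 : ℝ) < κ by positivity)
    push_cast
    linarith
  have hlogρ : 0 ≤ Real.log ρ := Real.log_nonneg hρ
  have hρe : 1 + Real.log ρ ≤ Real.exp (κ / 16) := by
    rw [← Real.log_le_iff_le_exp (by positivity)]
    linarith
  refine ⟨⌈2 * Real.log X⌉₊, ?_, ?_⟩
  · have hle : (A : ℝ) * κ ^ 3 + 12800 * (κ : ℝ) ^ 5 * ρ ^ 2 + 1 ≤ X := by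
      have h1 : (A : ℝ) * κ ^ 3 ≤ A * κ ^ 5 * ρ ^ 2 := by
        rw [mul_assoc]
        apply mul_le_mul_of_nonneg_left _ (by positivity)
        calc (κ : ℝ) ^ 3 ≤ κ ^ 5 := pow_le_pow_right₀ hκ' (by norm_num)
          _ ≤ _ := le_mul_of_one_le_right (by positivity) (one_le_pow₀ hρ)
      have h2 : 1 ≤ (κ : ℝ) ^ 5 * ρ ^ 2 :=
        one_le_mul_of_one_le_of_one_le (one_le_pow₀ hκ') (one_le_pow₀ hρ)
      have h3 : X = A * κ ^ 5 * ρ ^ 2 + 12800 * (κ : ℝ) ^ 5 * ρ ^ 2 + κ ^ 5 * ρ ^ 2 := by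
        rw [hX]; ring
      linarith
    refine hle.trans ?_
    have h4 := Nat.le_ceil (2 * Real.log X)
    -- The factor 2 in l is there because log 2 ≥ 1/2.
    have h5 : Real.log X ≤ (⌈2 * Real.log X⌉₊ : ℕ) * Real.log 2 := by
      have h6 := Real.log_two_gt_d9
      have h7 := Real.log_nonneg hX1
      nlinarith
    rw [← Real.log_pow] at h5
    exact (Real.log_le_log_iff (by linarith) (by positivity)).1 h5
  · have h1 := Nat.ceil_lt_add_one (show 0 ≤ 2 * Real.log X by
      linarith [Real.log_nonneg hX1])
    have h2 := Real.add_one_le_exp ((κ : ℝ) / 16)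
    have h3 : (0 : ℝ) ≤ A := by positivity
    have h4 : (1 : ℝ) ≤ Real.exp (κ / 16) := Real.one_le_exp (by positivity)
    nlinarith

theorem exists_parameters (A : ℕ) {c : ℝ} (hc : 0 < c) :
    ∃ C : ℝ, 0 < C ∧ ∀ (n κ : ℕ) (ρ : ℝ), 2 ≤ n → 1 ≤ ρ →
      C * (Real.log n ^ 2 + Real.log (1 + Real.log ρ)) ≤ κ →
      ∃ L l : ℕ, 1 ≤ κ ∧ 1 ≤ L ∧ n ≤ 3 ^ L ∧ 2 * L + 1 ≤ κ ∧ 1 + 4 * Real.log n ≤ κ ∧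
        (A : ℝ) * κ ^ 3 + 12800 * (κ : ℝ) ^ 5 * ρ ^ 2 + 1 ≤ 2 ^ l ∧
        (∀ m : ℕ, 1 ≤ m → m ≤ n →
          m * Real.exp (-(κ * (max 1 (m / (16 * L)) : ℕ) / (16 * m))) ≤ 1 ∧
          12 * (m : ℝ) ^ 2 * Real.exp (-(κ * (max 1 (m / (16 * L)) : ℕ) / (16 * m))) ≤
            Real.exp (-((c + 1) * Real.log n)) / 2) ∧
        ∀ s : ℕ, s ≤ n * κ → s * (2 * l * Real.exp (-((κ : ℝ) / 4))) ≤
          Real.exp (-((c + 1) * Real.log n)) / 2 := by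
  set B : ℝ := 2 * (A + 12801) + 165 with hB
  have hB0 : 0 < B := by positivity
  -- The first summand serves expansion with D = c + 8, the second concentration. The target
  -- exponent is c + 1 because up to n calls are summed.
  set C : ℝ := 1280 * (c + 8) + 16 * (c + 2 + 128 * B) with hC
  refine ⟨C, by positivity, fun n κ ρ hn hρ hκ => ?_⟩
  set ℓ := Real.log n with hℓ
  have hn' : (2 : ℝ) ≤ n := by exact_mod_cast hn
  have hℓ1 : 0.69 < ℓ := by
    have := Real.log_le_log (by norm_num) hn'
    linarith [Real.log_two_gt_d9]
  have hnexp : (n : ℝ) = Real.exp ℓ := (Real.exp_log (by positivity)).symm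
  have hlogρ : 0 ≤ Real.log ρ := Real.log_nonneg hρ
  have hll : 0 ≤ Real.log (1 + Real.log ρ) := Real.log_nonneg (by linarith)
  have hκ1 : C * ℓ ^ 2 ≤ κ := le_trans (by
    apply mul_le_mul_of_nonneg_left _ (by positivity)
    linarith) hκ
  have hκ2 : 16 * Real.log (1 + Real.log ρ) ≤ κ := by
    refine le_trans ?_ hκ
    apply mul_le_mul (by rw [hC]; linarith) _ hll (by positivity)
    linarith [sq_nonneg ℓ]
  have hκ3 : 20 * ℓ ≤ κ := by
    refine le_trans ?_ hκ1
    have : C ≥ 40 := by rw [hC]; linarith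
    nlinarith
  have hκ4 : (1 : ℝ) ≤ κ := by linarith
  have hκ5 : 1 ≤ κ := by exact_mod_cast hκ4
  obtain ⟨l, hl1, hl2⟩ := exists_dyadic_bound A hκ5 hρ hκ2
  have hLle := Nat.ceil_lt_add_one (show 0 ≤ ℓ by linarith)
  have hLge := Nat.le_ceil ℓ
  have hL1 : 1 ≤ ⌈ℓ⌉₊ := Nat.one_le_ceil_iff.2 (by linarith)
  refine ⟨⌈ℓ⌉₊, l, hκ5, hL1, ?_, ?_, by linarith, hl1, ?_, ?_⟩
  · have : (n : ℝ) ≤ 3 ^ ⌈ℓ⌉₊ := by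
      calc (n : ℝ) = Real.exp ℓ := hnexp
        _ ≤ Real.exp (⌈ℓ⌉₊ * 1) := Real.exp_le_exp.2 (by simpa using hLge)
        _ = Real.exp 1 ^ ⌈ℓ⌉₊ := Real.exp_nat_mul _ _
        _ ≤ _ := pow_le_pow_left₀ (Real.exp_pos _).le (by linarith [Real.exp_one_lt_d9]) _
    exact_mod_cast this
  · have : (2 * (⌈ℓ⌉₊ : ℝ) + 1) ≤ κ := by linarith
    exact_mod_cast this
  · intro m hm1 hmn
    have hmn' : (m : ℝ) ≤ Real.exp ℓ := by
      rw [← hnexp]; exact_mod_cast hmn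
    have hz := exp_neg_div_window_le (κ := κ) (m := m) (n := n) (L := ⌈ℓ⌉₊) (D := c + 8)
      (by linarith) hℓ.symm hm1 hL1 (by linarith) (by
        refine le_trans ?_ hκ1
        apply mul_le_mul_of_nonneg_right _ (sq_nonneg ℓ)
        rw [hC]
        linarith)
    rw [← hℓ] at hz
    constructor
    · calc _ ≤ Real.exp ℓ * Real.exp (-((c + 8) * ℓ)) := by gcongr
        _ = Real.exp (-((c + 7) * ℓ)) := by rw [← Real.exp_add]; congr 1; ring
        _ ≤ 1 := Real.exp_le_one_iff.2 (by nlinarith)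
    · have h24 : 24 ≤ Real.exp (5 * ℓ) := by
        have h1 : Real.exp (5 * ℓ) = (n : ℝ) ^ 5 := by
          rw [hnexp, ← Real.exp_nat_mul]
          norm_num
        rw [h1]
        calc (24 : ℝ) ≤ 2 ^ 5 := by norm_num
          _ ≤ _ := by gcongr
      calc _ ≤ 12 * Real.exp ℓ ^ 2 * Real.exp (-((c + 8) * ℓ)) := by gcongr
        _ = 12 * Real.exp (-((c + 6) * ℓ)) := by
          rw [mul_assoc, ← Real.exp_nat_mul, ← Real.exp_add]; congr 2; push_cast; ring
        _ ≤ (Real.exp (5 * ℓ) / 2) * Real.exp (-((c + 6) * ℓ)) := by gcongr; linarith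
        _ = Real.exp (-((c + 1) * ℓ)) / 2 := by
          rw [div_mul_eq_mul_div, ← Real.exp_add]; congr 2; ring
  · intro s hs
    have hs' : (s : ℝ) ≤ Real.exp ℓ * κ := by
      rw [← hnexp]; exact_mod_cast hs
    have hκexp : (κ : ℝ) ≤ 16 * Real.exp (κ / 16) := by
      linarith [Real.add_one_le_exp ((κ : ℝ) / 16)]
    -- The constant B is hidden in a power of n, using log n > 1/2; this is why 128B enters `C`.
    have hBexp : 64 * B ≤ Real.exp (128 * B * ℓ) := by
      have := Real.add_one_le_exp (128 * B * ℓ)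
      nlinarith
    have hκ6 : (c + 2 + 128 * B) * ℓ ≤ κ / 8 := by
      have h1 : 16 * (c + 2 + 128 * B) * ℓ ^ 2 ≤ κ := le_trans (by
        apply mul_le_mul_of_nonneg_right _ (sq_nonneg ℓ)
        rw [hC]
        linarith) hκ1
      have h2 : 0 ≤ (c + 2 + 128 * B) * ℓ := by positivity
      nlinarith
    calc (s : ℝ) * (2 * l * Real.exp (-((κ : ℝ) / 4)))
        ≤ (Real.exp ℓ * (16 * Real.exp (κ / 16))) *
          (2 * (B * Real.exp (κ / 16)) * Real.exp (-((κ : ℝ) / 4))) := by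
          gcongr
          exact hs'.trans (by gcongr)
      _ = 32 * B * Real.exp (ℓ - κ / 8) := by
          have : Real.exp (ℓ - κ / 8) = Real.exp ℓ * Real.exp (κ / 16) * Real.exp (κ / 16) *
              Real.exp (-((κ : ℝ) / 4)) := by
            rw [← Real.exp_add, ← Real.exp_add, ← Real.exp_add]; congr 1; ring
          rw [this]; ring
      _ ≤ (Real.exp (128 * B * ℓ) / 2) * Real.exp (ℓ - (c + 2 + 128 * B) * ℓ) := by
          gcongr
          linarith
      _ = Real.exp (-((c + 1) * ℓ)) / 2 := by
          rw [div_mul_eq_mul_div, ← Real.exp_add]; congr 2; ring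

end Parameters

/-! ### From labels back to ranked items -/

section Labelling

variable {n : ℕ}

theorem mem_topLabels {π : Equiv.Perm (Fin n)} {k : ℕ} {a : Fin n} :
    a ∈ topLabels π k ↔ rankOf π a ≤ k := by
  simp [topLabels]

theorem card_topLabels (π : Equiv.Perm (Fin n)) {k : ℕ} (hk : k ≤ n) :
    (topLabels π k).card = k := by
  have h : (topLabels π k).card = (Finset.univ.filter fun i : Fin n => (i : ℕ) < k).card := by
    refine Finset.card_equiv π.symm fun a => ?_
    simp [topLabels, rankOf]
  rw [h, Fin.card_filter_val_lt, min_eq_right hk]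

theorem sum_rankOf (π : Equiv.Perm (Fin n)) (f : ℕ → ℝ) :
    ∑ a, f (rankOf π a) = ∑ i ∈ Finset.Icc 1 n, f i := by
  rw [← Equiv.sum_comp π]
  simp only [rankOf, Equiv.symm_apply_apply]
  rw [← Finset.sum_range fun i => f (i + 1), Finset.range_eq_Ico, Finset.sum_Ico_add' f 0 n 1]
  rfl

variable {k : ℕ} {v θ : ℕ → ℝ}

theorem separates_topLabels (hkn : k < n) (hk : 1 ≤ k) (hθ : ∀ i, θ i = Real.exp (v i))
    (hanti : AntitoneOn θ (Set.Icc 1 n)) (hlt : θ (k + 1) < θ k) (π : Equiv.Perm (Fin n)) :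
    Separates (fun a => v (rankOf π a)) (topLabels π k) (θ (k + 1)) (θ k) := by
  have hr : ∀ a, rankOf π a ∈ Set.Icc 1 n := fun a =>
    ⟨Nat.le_add_left 1 _, (π.symm a).is_lt⟩
  refine ⟨by rw [hθ]; exact Real.exp_pos _, hlt, fun a ha => ?_, fun a ha => ?_⟩
  · rw [← hθ]
    exact hanti (hr a) ⟨hk, hkn.le⟩ (mem_topLabels.1 ha)
  · rw [← hθ]
    rw [mem_topLabels, not_le] at ha
    exact hanti ⟨by omega, hkn⟩ (hr a) ha

/-- Each item i > k contributes at least 1, as 0 < θ_k - θ_i < θ_k, and the summand k accounts for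
the top items, whose own terms may be tiny. This absorbs the cost of the first q₀ rounds. -/
theorem le_complexity (hkn : k < n) (hk : 1 ≤ k) (hθ : ∀ i, θ i = Real.exp (v i))
    (hanti : AntitoneOn θ (Set.Icc 1 n)) (hlt : θ (k + 1) < θ k) :
    (n : ℝ) ≤ complexity n k θ := by
  have h1 : ((n - k : ℕ) : ℝ) ≤ ∑ i ∈ Finset.Icc (k + 1) n, θ k ^ 2 / (θ k - θ i) ^ 2 := by
    have : ((n - k : ℕ) : ℝ) = ∑ i ∈ Finset.Icc (k + 1) n, (1 : ℝ) := by simp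
    rw [this]
    refine Finset.sum_le_sum fun i hi => ?_
    rw [Finset.mem_Icc] at hi
    have h2 : θ i ≤ θ (k + 1) := hanti ⟨by omega, hkn⟩ ⟨by omega, hi.2⟩ hi.1
    have h3 : 0 < θ i := by rw [hθ]; exact Real.exp_pos _
    have h4 : 0 < θ k - θ i := by linarith
    rw [one_le_div (by positivity)]
    gcongr
    linarith
  have h2 : 0 ≤ ∑ i ∈ Finset.Icc 1 k, θ (k + 1) ^ 2 / (θ (k + 1) - θ i) ^ 2 :=
    Finset.sum_nonneg fun i _ => by positivity
  rw [Nat.cast_sub hkn.le] at h1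
  unfold complexity
  linarith

theorem sum_weight_le (hkn : k < n) (hk : 1 ≤ k) (hθ : ∀ i, θ i = Real.exp (v i))
    (hanti : AntitoneOn θ (Set.Icc 1 n)) (hlt : θ (k + 1) < θ k) (π : Equiv.Perm (Fin n)) :
    ∑ a, weight (fun a => v (rankOf π a)) (topLabels π k) (θ (k + 1)) (θ k) a ≤
      2 * complexity n k θ := by
  have hw : ∀ a, weight (fun a => v (rankOf π a)) (topLabels π k) (θ (k + 1)) (θ k) a =
      (fun i => 1 + if i ≤ k then θ (k + 1) ^ 2 / (θ (k + 1) - θ i) ^ 2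
        else θ k ^ 2 / (θ k - θ i) ^ 2) (rankOf π a) := by
    intro a
    simp only [weight, mem_topLabels, hθ]
  have hunion : Finset.Icc 1 n = Finset.Icc 1 k ∪ Finset.Icc (k + 1) n := by
    ext i; simp only [Finset.mem_union, Finset.mem_Icc]; omega
  have hdisj : Disjoint (Finset.Icc 1 k) (Finset.Icc (k + 1) n) := by
    rw [Finset.disjoint_left]
    intro i; simp only [Finset.mem_Icc]; omega
  have h1 := le_complexity hkn hk hθ hanti hlt
  simp_rw [hw]
  rw [sum_rankOf π (fun i => 1 + if i ≤ k then θ (k + 1) ^ 2 / (θ (k + 1) - θ i) ^ 2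
        else θ k ^ 2 / (θ k - θ i) ^ 2), Finset.sum_add_distrib, hunion,
    Finset.sum_union hdisj (f := fun i => if i ≤ k then θ (k + 1) ^ 2 / (θ (k + 1) - θ i) ^ 2
        else θ k ^ 2 / (θ k - θ i) ^ 2), ← hunion]
  have e1 : ∑ i ∈ Finset.Icc 1 k, (if i ≤ k then θ (k + 1) ^ 2 / (θ (k + 1) - θ i) ^ 2
        else θ k ^ 2 / (θ k - θ i) ^ 2) =
      ∑ i ∈ Finset.Icc 1 k, θ (k + 1) ^ 2 / (θ (k + 1) - θ i) ^ 2 :=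
    Finset.sum_congr rfl fun i hi => if_pos (Finset.mem_Icc.1 hi).2
  have e2 : ∑ i ∈ Finset.Icc (k + 1) n, (if i ≤ k then θ (k + 1) ^ 2 / (θ (k + 1) - θ i) ^ 2
        else θ k ^ 2 / (θ k - θ i) ^ 2) =
      ∑ i ∈ Finset.Icc (k + 1) n, θ k ^ 2 / (θ k - θ i) ^ 2 :=
    Finset.sum_congr rfl fun i hi => if_neg (by have := (Finset.mem_Icc.1 hi).1; omega)
  rw [e1, e2]
  simp only [Finset.sum_const, Nat.card_Icc, Nat.add_sub_cancel, nsmul_eq_mul, mul_one]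
  have : (0 : ℝ) ≤ k := by positivity
  unfold complexity at *
  linarith

/-- Every item is at least hi - lo from its reference score; the uniform bound tells how many dyadic
blocks of rounds must be controlled. -/
theorem Separates.weight_le {v : Fin n → ℝ} {T : Finset (Fin n)} {lo hi : ℝ}
    (hT : Separates v T lo hi) (a : Fin n) : weight v T lo hi a ≤ 2 * (hi / (hi - lo)) ^ 2 := by
  have hlo := hT.lo_pos
  have hlt := hT.lt
  have hg : 0 < hi - lo := by linarith
  have h1 : 1 ≤ (hi / (hi - lo)) ^ 2 := one_le_pow₀ (by rw [one_le_div hg]; linarith)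
  have h2 : (if a ∈ T then lo ^ 2 / (lo - Real.exp (v a)) ^ 2
      else hi ^ 2 / (hi - Real.exp (v a)) ^ 2) ≤ (hi / (hi - lo)) ^ 2 := by
    rw [div_pow]
    split_ifs with h
    · have := hT.le_of_mem a h
      rw [sub_sq_comm]
      gcongr
    · have := hT.le_of_notMem a h
      gcongr
  unfold weight
  rw [two_mul]
  refine add_le_add h1 ?_
  convert h2

end Labelling

end TopK

/-! ### Assembly and final constants -/

theorem mainTheorem3 :
    ∃ A₀ : ℕ, ∀ A : ℕ, A₀ ≤ A →
    ∃ K : ℝ, 0 < K ∧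
    ∀ c : ℝ, 0 < c →
    ∃ C : ℝ, 0 < C ∧
    ∀ (n k κ : ℕ) (v θ : ℕ → ℝ),
      1 ≤ k → k < n →
      (∀ i, θ i = Real.exp (v i)) →
      AntitoneOn θ (Set.Icc 1 n) →
      θ (k + 1) < θ k →
      C * (Real.log n ^ 2 + Real.log (1 + Real.log (θ k / (θ k - θ (k + 1))))) ≤ (κ : ℝ) →
      ENNReal.ofReal (1 - 1 / (n : ℝ) ^ c) ≤
        TopK.successProb κ (A * κ ^ 3) n k v (K * (κ : ℝ) ^ 7 * TopK.complexity n k θ) := by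
  -- 10000 is what makes κx ≤ 1/100 in `mul_sqrt_le`. In K, the part A + 1 covers q₀ + 1 rounds and
  -- 51200 = 2·25600 covers the total weight, which is at most twice the complexity.
  refine ⟨10000, fun A hA => ⟨A + 51201, by positivity, fun c hc => ?_⟩⟩
  obtain ⟨C, hC, hpar⟩ := TopK.exists_parameters A hc
  refine ⟨C, hC, fun n k κ v θ hk hkn hθ hanti hlt hκ => ?_⟩
  have hθ0 : 0 < θ (k + 1) := by rw [hθ]; exact Real.exp_pos _
  obtain ⟨L, l, hκ1, hL1, hL, hLκ, hlogκ, hl, he₁, he₂⟩ := hpar n κ (θ k / (θ k - θ (k + 1)))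
    (by omega) (by rw [one_le_div (by linarith)]; linarith) hκ
  have hH := TopK.le_complexity hkn hk hθ hanti hlt
  set H := TopK.complexity n k θ with hHdef
  have hn0 : (0 : ℝ) < n := by
    have : 0 < n := by omega
    exact_mod_cast this
  have hH0 : 0 ≤ H := hn0.le.trans hH
  have hκ' : (1 : ℝ) ≤ κ := by exact_mod_cast hκ1
  set e := Real.exp (-((c + 1) * Real.log n)) / 2 with he
  have he0 : 0 ≤ e := by positivity
  have key : ∀ π : Equiv.Perm (Fin n), ENNReal.ofReal (1 - 1 / (n : ℝ) ^ c) ≤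
      TopK.algPairwise κ (A * κ ^ 3) (fun a => v (TopK.rankOf π a)) Finset.univ k
        {o | ∃ t : ℕ, o = .halted (TopK.topLabels π k) t ∧
          (t : ℝ) ≤ (A + 51201) * (κ : ℝ) ^ 7 * H} := by
    intro π
    have hT := TopK.separates_topLabels hkn hk hθ hanti hlt π
    have hsum := TopK.sum_weight_le hkn hk hθ hanti hlt π
    have hfail := hT.algPairwise_fail_le (q₀ := A * κ ^ 3) (l := l) hκ1 hL1 hL hLκ
      (Nat.mul_le_mul_right _ hA)
      (fun a => by
        refine le_trans ?_ hl
        push_cast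
        have := mul_le_mul_of_nonneg_left (hT.weight_le a)
          (show 0 ≤ 6400 * (κ : ℝ) ^ 5 by positivity)
        linarith)
      (e₁ := ENNReal.ofReal e) (e₂ := ENNReal.ofReal e)
      (fun W idx hW hinj hmem => by
        have hWn : W.card ≤ n := by simpa using Finset.card_le_univ W
        obtain ⟨h1, h2⟩ := he₁ W.card (by omega) hWn
        exact (TopK.pairLaw_not_expanding hW κ _ hinj (fun i _ => hmem i) h1).trans
          (ENNReal.ofReal_le_ofReal h2))
      (fun s hs => ENNReal.ofReal_le_ofReal (he₂ s hs))
      (M := (A + 51201) * (κ : ℝ) ^ 6 * H) (by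
        push_cast
        have h3 : (A : ℝ) * κ ^ 3 + 1 ≤ (A + 1) * κ ^ 5 := by
          have h4 : (κ : ℝ) ^ 3 ≤ κ ^ 5 := pow_le_pow_right₀ hκ' (by norm_num)
          have h5 : (1 : ℝ) ≤ κ ^ 5 := one_le_pow₀ hκ'
          have h6 : (A : ℝ) * κ ^ 3 ≤ A * κ ^ 5 := by gcongr
          linarith
        calc _ ≤ (H * ((A + 1) * (κ : ℝ) ^ 5) + 25600 * (κ : ℝ) ^ 5 * (2 * H)) * κ := by
              gcongr
          _ = _ := by ring)
      Finset.univ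
    rw [Finset.univ_inter, TopK.card_topLabels π hkn.le, Finset.card_univ, Fintype.card_fin]
      at hfail
    have := TopK.isProbabilityMeasure_algPairwise κ (A * κ ^ 3)
      (fun a => v (TopK.rankOf π a)) Finset.univ k
    set P := TopK.algPairwise κ (A * κ ^ 3) (fun a => v (TopK.rankOf π a)) Finset.univ k
    have hfail' : P (TopK.haltedWithin (TopK.topLabels π k)
        ((A + 51201) * (κ : ℝ) ^ 6 * H * (1 + 4 * Real.log n)))ᶜ ≤
        ENNReal.ofReal (1 / (n : ℝ) ^ c) := by
      refine hfail.trans (le_of_eq ?_)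
      rw [← ENNReal.ofReal_add he0 he0, ← ENNReal.ofReal_natCast,
        ← ENNReal.ofReal_mul (by positivity)]
      congr 1
      rw [he, add_halves, Real.rpow_def_of_pos hn0, one_div, ← Real.exp_neg]
      nth_rewrite 1 [← Real.exp_log hn0]
      rw [← Real.exp_add]
      congr 1
      ring
    have hone : 1 ≤ P (TopK.haltedWithin (TopK.topLabels π k)
        ((A + 51201) * (κ : ℝ) ^ 6 * H * (1 + 4 * Real.log n))) +
        ENNReal.ofReal (1 / (n : ℝ) ^ c) := by
      rw [← prob_add_prob_compl (μ := P) (TopK.measurableSet_outcome (TopK.haltedWithin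
        (TopK.topLabels π k) ((A + 51201) * (κ : ℝ) ^ 6 * H * (1 + 4 * Real.log n))))]
      gcongr
    rw [ENNReal.ofReal_sub _ (by positivity), ENNReal.ofReal_one]
    refine (tsub_le_iff_right.2 hone).trans (measure_mono ?_)
    rintro o ⟨t, rfl, ht⟩
    refine ⟨t, rfl, ht.trans ?_⟩
    -- The number of recursion levels costs the seventh power of κ, since 1 + 4 log n ≤ κ.
    calc (A + 51201) * (κ : ℝ) ^ 6 * H * (1 + 4 * Real.log n)
        ≤ (A + 51201) * (κ : ℝ) ^ 6 * H * κ := by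
          gcongr
      _ = _ := by ring
  -- The bound holds for each labelling, so averaging over the n! permutations preserves it.
  rw [TopK.successProb, ENNReal.le_div_iff_mul_le (Or.inl (by exact_mod_cast n.factorial_ne_zero))
    (Or.inl (ENNReal.natCast_ne_top _))]
  calc ENNReal.ofReal (1 - 1 / (n : ℝ) ^ c) * n.factorial
      = ∑ _π : Equiv.Perm (Fin n), ENNReal.ofReal (1 - 1 / (n : ℝ) ^ c) := by
        rw [Finset.sum_const, Finset.card_univ, Fintype.card_perm, Fintype.card_fin,
          nsmul_eq_mul, mul_comm]
    _ ≤ _ := Finset.sum_le_sum fun π _ => key π
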